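/- Let $n\le m$ be natural numbers and let $e_1,\dots,e_m\in\mathbb{R}^n$ be unit vectors such that any $n$ of them are linearly independent. Put $\mathbb{R}_+=(0,\infty)$, $\pi(\mathbf t)=t_1e_1+\cdots+t_me_m$ for $\mathbf t=(t_1,\dots,t_m)\in\mathbb{R}^m$, let $\Omega=\pi\big((\mathbb{R}_+)^m\big)$ be the polyhedral cone spanned by $e_1,\dots,e_m$, and let $T_\Omega=\mathbb{R}^n+i\Omega\subset\mathbb{C}^n$. For $1<p<\infty$ let $H^p(T_\Omega)$ be the space of holomorphic functions $F$ on $T_\Omega$ with $$\|F\|_{H^p(T_\Omega)}=\Big(\sup_{y\in\Omega}\int_{\mathbb{R}^n}|F(x+iy)|^p\,dx\Big)^{1/p}<\infty .$$ Let $P_t(s)=\frac1\pi\frac{t}{t^2+s^2}$ be the Poisson kernel on $\mathbb{R}$, let $f*_\mu P_t(x)=\int_{\mathbb{R}}f(x-se_\mu)P_t(s)\,ds$ be the Poisson integral along the line $e_\mu$, and for $\mathbf t\in(\mathbb{R}_+)^m$ let $f*P_{\mathbf t}=f*_1P_{t_1}\cdots*_mP_{t_m}$ be the iterated Poisson integral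 (first along $e_1$, last along $e_m$). **Theorem.** Let $1<p<\infty$ and $F\in H^p(T_\Omega)$. Then there exists $F^b\in L^p(\mathbb{R}^n)$ such that $$F(x+i\pi(\mathbf t))=F^b*P_{\mathbf t}(x)\qquad\text{for all }(x,\mathbf t)\in\mathbb{R}^n\times(\mathbb{R}_+)^m,$$ where the integral defining the right-hand side converges absolutely, i.e. $\mathbf s\mapsto F^b\big(x-\sum_j s_je_j\big)\prod_jP_{t_j}(s_j)$ is integrable on $\mathbb{R}^m$ for all such $(x,\mathbf t)$. Moreover, if $F$ is continuous on $\overline{T_\Omega}$, then $F^b$ can in addition be represented by the function $F^b(x)=\lim_{\mathbf t\to0,\ \mathbf t\in(\mathbb{R}_+)^m}F(x+i\pi(\mathbf t))$, the limit existing for every $x\in\mathbb{R}^n$. -/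

import Mathlib

open Set Filter Topology MeasureTheory
open scoped ENNReal

noncomputable section

namespace TubeHardy

/-- The lifting projection `π : ℝ^m → ℝ^n`, `π(t) = t₁ e₁ + ⋯ + t_m e_m`. -/
def proj {n m : ℕ} (e : Fin m → EuclideanSpace ℝ (Fin n)) (t : Fin m → ℝ) :
    EuclideanSpace ℝ (Fin n) :=
  ∑ j, t j • e j

/-- The open orthant `(ℝ₊)^m`. -/
def orthant (m : ℕ) : Set (Fin m → ℝ) := {t | ∀ j, 0 < t j}

/-- The polyhedral cone `Ω = {λ₁ e₁ + ⋯ + λ_m e_m ; λ₁, …, λ_m > 0}`. -/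
def cone {n m : ℕ} (e : Fin m → EuclideanSpace ℝ (Fin n)) : Set (EuclideanSpace ℝ (Fin n)) :=
  proj e '' orthant m

/-- The point `x + i y` of `ℂ^n`. -/
def cpoint {n : ℕ} (x y : EuclideanSpace ℝ (Fin n)) : EuclideanSpace ℂ (Fin n) :=
  WithLp.toLp 2 fun k => (x k : ℂ) + Complex.I * (y k : ℂ)

/-- The tube domain `T_Ω = ℝ^n + i Ω`. -/
def tube {n : ℕ} (Ω : Set (EuclideanSpace ℝ (Fin n))) : Set (EuclideanSpace ℂ (Fin n)) :=
  {z | ∃ x : EuclideanSpace ℝ (Fin n), ∃ y ∈ Ω, z = cpoint x y}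

/-- The Hardy norm `(sup_{y ∈ Ω} ∫ |F(x + i y)|^p dx)^{1/p}`, with values in `[0, ∞]`. -/
def hardyNorm {n : ℕ} (Ω : Set (EuclideanSpace ℝ (Fin n))) (p : ℝ)
    (F : EuclideanSpace ℂ (Fin n) → ℂ) : ℝ≥0∞ :=
  (⨆ y ∈ Ω, ∫⁻ x : EuclideanSpace ℝ (Fin n), ‖F (cpoint x y)‖ₑ ^ p) ^ (1 / p)

/-- `F ∈ H^p(T_Ω)`: `F` is holomorphic on `T_Ω` and has finite Hardy norm.  Values of `F` outside
`T_Ω` play no role. -/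
def MemHardy {n : ℕ} (Ω : Set (EuclideanSpace ℝ (Fin n))) (p : ℝ)
    (F : EuclideanSpace ℂ (Fin n) → ℂ) : Prop :=
  DifferentiableOn ℂ F (tube Ω) ∧ hardyNorm Ω p F < ∞

/-- The Poisson kernel `P_t(s) = (1/π) t / (t² + s²)` on `ℝ`. -/
def poisson (t s : ℝ) : ℝ := 1 / Real.pi * (t / (t ^ 2 + s ^ 2))

/-- The Poisson integral of `f` along the line `v`: `x ↦ ∫ f(x - s v) P_t(s) ds`. -/
def linePoisson {n : ℕ} (v : EuclideanSpace ℝ (Fin n)) (t : ℝ)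
    (f : EuclideanSpace ℝ (Fin n) → ℂ) (x : EuclideanSpace ℝ (Fin n)) : ℂ :=
  ∫ s : ℝ, f (x - s • v) * (poisson t s : ℂ)

/-- The iterated Poisson integral `f *₁ P_{t₁} ⋯ *_m P_{t_m}`: first along `e₁`, last along
`e_m`. -/
def iterPoisson {n : ℕ} : {m : ℕ} → (Fin m → EuclideanSpace ℝ (Fin n)) → (Fin m → ℝ) →
    (EuclideanSpace ℝ (Fin n) → ℂ) → EuclideanSpace ℝ (Fin n) → ℂ
  | 0, _, _, f => f
  | m + 1, e, t, f =>
      linePoisson (e (Fin.last m)) (t (Fin.last m))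
        (iterPoisson (fun j : Fin m => e j.castSucc) (fun j : Fin m => t j.castSucc) f)

end TubeHardy

end

open TubeHardy

/-! ### Uniform convexity of `|·|^p` and its consequence for bounded sequences in `L^p` -/

/-! The slices `f k = F(· + iπ(τ k))` with `τ k → 0` are bounded in `L^p`, and `F^b` is a limit of
convex combinations of them. Strong convergence of such combinations replaces weak compactness:
near-minimizers of the norm over the convex hulls of the tails form a Cauchy sequence, because
`|·|^p` is uniformly convex for `p > 1` (`exists_norm_sub_rpow_le`,
`exists_convexHull_tail_tendsto`).

Inside the tube the formula is one-dimensional. For `y ∈ Ω` the function `ζ ↦ F(x + iy + ζ e_j)` is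
holomorphic on the closed upper half plane, and it is bounded there by the sub-mean value property
(`exists_norm_le_of_lintegral_le`). The classical Poisson formula thus applies along each generator,
and iteration gives `f k * P_t (x) = F(x + i(π(τ k) + π(t)))`, which tends to `F(x + iπ(t))` by
continuity.

To pass to the limit at every `x`, one needs `f ↦ f * P_t (x)` to be bounded on `L^p` uniformly in
`x` (`exists_lintegral_enorm_mul_poisson_le`). Here independence enters: `n` of the directions give
a linear change of variables on `ℝ^n`, and the others only average. An affine functional that
converges along `f k` has the same limit along tail combinations, so the limit function satisfies
the formula. If `F` is continuous up to the boundary, the pointwise limit of the slices is a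
representative of the same `L^p` class. -/

lemma norm_midpoint_rpow_le {p : ℝ} (hp : 1 < p) (a b : ℂ) :
    ‖(1 / 2 : ℝ) • (a + b)‖ ^ p ≤ (‖a‖ ^ p + ‖b‖ ^ p) / 2 := by
  have h1 : ‖(1 / 2 : ℝ) • (a + b)‖ ≤ (1 / 2 : ℝ) * ‖a‖ + (1 / 2 : ℝ) * ‖b‖ := by
    rw [norm_smul, Real.norm_of_nonneg (by norm_num), ← mul_add]
    gcongr
    exact norm_add_le a b
  have h2 := (convexOn_rpow hp.le).2 (norm_nonneg a) (norm_nonneg b)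
    (by norm_num : (0 : ℝ) ≤ 1 / 2) (by norm_num : (0 : ℝ) ≤ 1 / 2) (by norm_num)
  simp only [smul_eq_mul] at h2
  calc _ ≤ ((1 / 2 : ℝ) * ‖a‖ + (1 / 2 : ℝ) * ‖b‖) ^ p :=
        Real.rpow_le_rpow (norm_nonneg _) h1 (by linarith)
    _ ≤ _ := h2
    _ = _ := by ring

/-- Strictness has two sources: strict convexity of the disc when the moduli agree, strict convexity
of `r ↦ r ^ p` when they differ. -/
lemma norm_midpoint_rpow_lt {p : ℝ} (hp : 1 < p) {a b : ℂ} (hab : a ≠ b) :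
    ‖(1 / 2 : ℝ) • (a + b)‖ ^ p < (‖a‖ ^ p + ‖b‖ ^ p) / 2 := by
  by_cases hn : ‖a‖ = ‖b‖
  · have h1 : ‖(1 / 2 : ℝ) • (a + b)‖ < ‖a‖ := by
      have := norm_combo_lt_of_ne (le_refl ‖a‖) hn.ge hab (by norm_num : (0 : ℝ) < 1 / 2)
        (by norm_num : (0 : ℝ) < 1 / 2) (by norm_num)
      rwa [smul_add]
    rw [← hn, add_self_div_two]
    exact Real.rpow_lt_rpow (norm_nonneg _) h1 (by linarith)
  · have h1 : ‖(1 / 2 : ℝ) • (a + b)‖ ≤ (1 / 2 : ℝ) * ‖a‖ + (1 / 2 : ℝ) * ‖b‖ := by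
      rw [norm_smul, Real.norm_of_nonneg (by norm_num), ← mul_add]
      gcongr
      exact norm_add_le a b
    have h2 := (strictConvexOn_rpow hp).2 (norm_nonneg a) (norm_nonneg b) hn
      (by norm_num : (0 : ℝ) < 1 / 2) (by norm_num : (0 : ℝ) < 1 / 2) (by norm_num)
    simp only [smul_eq_mul] at h2
    calc _ ≤ ((1 / 2 : ℝ) * ‖a‖ + (1 / 2 : ℝ) * ‖b‖) ^ p :=
          Real.rpow_le_rpow (norm_nonneg _) h1 (by linarith)
      _ < _ := h2
      _ = _ := by ring

/-- A quantitative form of the strict convexity of `|·|^p`. -/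
lemma exists_norm_sub_rpow_le {p : ℝ} (hp : 1 < p) {ε : ℝ} (hε : 0 < ε) :
    ∃ C : ℝ, 0 ≤ C ∧ ∀ a b : ℂ, ‖a - b‖ ^ p ≤ ε * (‖a‖ ^ p + ‖b‖ ^ p) +
      C * ((‖a‖ ^ p + ‖b‖ ^ p) / 2 - ‖(1 / 2 : ℝ) • (a + b)‖ ^ p) := by
  have hp0 : 0 < p := by linarith
  -- Every term is homogeneous of degree `p`, so normalized pairs suffice. `K` holds those not
  -- already absorbed by the `ε` term; it is compact and misses the diagonal, so the convexity
  -- defect is positive on it and the quotient is bounded.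
  set K : Set (ℂ × ℂ) := {z | ‖z.1‖ ^ p + ‖z.2‖ ^ p = 1 ∧ ε ≤ ‖z.1 - z.2‖ ^ p} with hK
  have c1 : Continuous fun z : ℂ × ℂ => ‖z.1‖ ^ p :=
    continuous_fst.norm.rpow_const fun _ => Or.inr hp0.le
  have c2 : Continuous fun z : ℂ × ℂ => ‖z.2‖ ^ p :=
    continuous_snd.norm.rpow_const fun _ => Or.inr hp0.le
  have c3 : Continuous fun z : ℂ × ℂ => ‖z.1 - z.2‖ ^ p :=
    (continuous_fst.sub continuous_snd).norm.rpow_const fun _ => Or.inr hp0.le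
  have c4 : Continuous fun z : ℂ × ℂ => ‖(1 / 2 : ℝ) • (z.1 + z.2)‖ ^ p :=
    ((continuous_fst.add continuous_snd).const_smul (1 / 2 : ℝ)).norm.rpow_const
      fun _ => Or.inr hp0.le
  have hKc : IsCompact K := by
    refine Metric.isCompact_of_isClosed_isBounded ?_ ?_
    · exact (isClosed_eq (c1.add c2) continuous_const).inter (isClosed_le continuous_const c3)
    · refine (Metric.isBounded_closedBall (x := (0 : ℂ × ℂ)) (r := 1)).subset ?_
      rintro ⟨a, b⟩ ⟨h, -⟩
      have ha : ‖a‖ ^ p ≤ 1 := by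
        have := Real.rpow_nonneg (norm_nonneg b) p
        simp only at h; linarith
      have hb : ‖b‖ ^ p ≤ 1 := by
        have := Real.rpow_nonneg (norm_nonneg a) p
        simp only at h; linarith
      rw [mem_closedBall_zero_iff, Prod.norm_def, max_le_iff]
      exact ⟨not_lt.1 fun h' => ha.not_gt (Real.one_lt_rpow h' hp0),
        not_lt.1 fun h' => hb.not_gt (Real.one_lt_rpow h' hp0)⟩
  have hpos : ∀ z ∈ K, 0 < (‖z.1‖ ^ p + ‖z.2‖ ^ p) / 2 - ‖(1 / 2 : ℝ) • (z.1 + z.2)‖ ^ p := by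
    rintro ⟨a, b⟩ ⟨-, h⟩
    refine sub_pos.2 (norm_midpoint_rpow_lt hp ?_)
    intro (hab : a = b)
    subst hab
    simp only [sub_self, norm_zero, Real.zero_rpow hp0.ne'] at h
    linarith
  obtain ⟨C, hC⟩ := hKc.exists_bound_of_continuousOn (f := fun z : ℂ × ℂ =>
      ‖z.1 - z.2‖ ^ p / ((‖z.1‖ ^ p + ‖z.2‖ ^ p) / 2 - ‖(1 / 2 : ℝ) • (z.1 + z.2)‖ ^ p))
    (c3.continuousOn.div (((c1.add c2).div_const 2).sub c4).continuousOn
      fun z hz => (hpos z hz).ne')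
  refine ⟨max C 0, le_max_right _ _, ?_⟩
  have key : ∀ a b : ℂ, ‖a‖ ^ p + ‖b‖ ^ p = 1 → ‖a - b‖ ^ p ≤ ε * (‖a‖ ^ p + ‖b‖ ^ p) +
      max C 0 * ((‖a‖ ^ p + ‖b‖ ^ p) / 2 - ‖(1 / 2 : ℝ) • (a + b)‖ ^ p) := by
    intro a b hab
    by_cases h : ε ≤ ‖a - b‖ ^ p
    · have hm : (a, b) ∈ K := ⟨hab, h⟩
      have h1 := (le_abs_self _).trans (hC _ hm)
      have h2 := hpos _ hm
      simp only at h1 h2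
      rw [div_le_iff₀ h2] at h1
      have h3 : C * ((‖a‖ ^ p + ‖b‖ ^ p) / 2 - ‖(1 / 2 : ℝ) • (a + b)‖ ^ p) ≤
          max C 0 * ((‖a‖ ^ p + ‖b‖ ^ p) / 2 - ‖(1 / 2 : ℝ) • (a + b)‖ ^ p) := by
        gcongr
        exact le_max_left _ _
      have : 0 ≤ ε * (‖a‖ ^ p + ‖b‖ ^ p) := by positivity
      linarith
    · have h2 : 0 ≤ max C 0 * ((‖a‖ ^ p + ‖b‖ ^ p) / 2 - ‖(1 / 2 : ℝ) • (a + b)‖ ^ p) :=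
        mul_nonneg (le_max_right _ _) (sub_nonneg.2 (norm_midpoint_rpow_le hp a b))
      rw [hab] at h2 ⊢
      linarith
  intro a b
  rcases (by positivity : 0 ≤ ‖a‖ ^ p + ‖b‖ ^ p).eq_or_lt with hS | hS
  · have ha : ‖a‖ ^ p = 0 := by
      have := Real.rpow_nonneg (norm_nonneg b) p
      have := Real.rpow_nonneg (norm_nonneg a) p
      linarith
    have hb : ‖b‖ ^ p = 0 := by linarith
    rw [Real.rpow_eq_zero (norm_nonneg _) hp0.ne', norm_eq_zero] at ha hb
    simp [ha, hb, Real.zero_rpow hp0.ne']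
  · set S := ‖a‖ ^ p + ‖b‖ ^ p with hSdef
    set l : ℝ := S ^ (-(1 / p)) with hl
    have hl0 : 0 < l := Real.rpow_pos_of_pos hS _
    have hlp : l ^ p = S⁻¹ := by
      rw [hl, ← Real.rpow_mul hS.le, neg_mul, one_div_mul_cancel hp0.ne', Real.rpow_neg_one]
    have hsc : ∀ c : ℂ, ‖l • c‖ ^ p = S⁻¹ * ‖c‖ ^ p := by
      intro c
      rw [norm_smul, Real.norm_of_nonneg hl0.le, Real.mul_rpow hl0.le (norm_nonneg _), hlp]
    have h := key (l • a) (l • b) (by rw [hsc, hsc, ← mul_add]; exact inv_mul_cancel₀ hS.ne')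
    rw [← smul_sub, ← smul_add, smul_comm, hsc, hsc, hsc, hsc, ← mul_add, ← hSdef] at h
    have h' := mul_le_mul_of_nonneg_left h hS.le
    have e1 : S * (S⁻¹ * ‖a - b‖ ^ p) = ‖a - b‖ ^ p := by field_simp
    have e2 : S * (ε * (S⁻¹ * S) + max C 0 * (S⁻¹ * S / 2 -
        S⁻¹ * ‖(1 / 2 : ℝ) • (a + b)‖ ^ p)) =
        ε * S + max C 0 * (S / 2 - ‖(1 / 2 : ℝ) • (a + b)‖ ^ p) := by field_simp
    rw [e1, e2] at h'
    exact h'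

section LpSequences

variable {α : Type*} [MeasurableSpace α] {μ : Measure α} {p : ℝ}

lemma integrable_norm_rpow_of_memLp (hp : 1 < p) {f : α → ℂ} (hf : MemLp f (ENNReal.ofReal p) μ) :
    Integrable (fun x => ‖f x‖ ^ p) μ := by
  have := hf.integrable_norm_rpow (by simp; linarith) ENNReal.ofReal_ne_top
  rwa [ENNReal.toReal_ofReal (by linarith)] at this

lemma eLpNorm_ofReal_eq (hp : 1 < p) {f : α → ℂ} (hf : MemLp f (ENNReal.ofReal p) μ) :
    eLpNorm f (ENNReal.ofReal p) μ = ENNReal.ofReal ((∫ x, ‖f x‖ ^ p ∂μ) ^ p⁻¹) := by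
  rw [hf.eLpNorm_eq_integral_rpow_norm (by simp; linarith) ENNReal.ofReal_ne_top,
    ENNReal.toReal_ofReal (by linarith)]

/-- A bounded sequence in `L^p`, `1 < p < ∞`, has convex combinations of its tails that converge
in `L^p`. -/
theorem exists_convexHull_tail_tendsto (hp : 1 < p) (f : ℕ → α → ℂ)
    (hf : ∀ k, MemLp (f k) (ENNReal.ofReal p) μ) (M : ℝ) (hM : ∀ k, ∫ x, ‖f k x‖ ^ p ∂μ ≤ M) :
    ∃ g : ℕ → α → ℂ, ∃ G : α → ℂ, (∀ k, g k ∈ convexHull ℝ (f '' Ici k)) ∧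
      (∀ k, MemLp (g k) (ENNReal.ofReal p) μ) ∧ MemLp G (ENNReal.ofReal p) μ ∧
      Tendsto (fun k => eLpNorm (g k - G) (ENNReal.ofReal p) μ) atTop (𝓝 0) := by
  have hp0 : 0 < p := by linarith
  have : Fact (1 ≤ ENNReal.ofReal p) := ⟨by simpa using hp.le⟩
  set N : (α → ℂ) → ℝ := fun h => ∫ x, ‖h x‖ ^ p ∂μ with hN
  have hN0 : ∀ h, 0 ≤ N h := fun h => integral_nonneg fun x => by positivity
  set C : ℕ → Set (α → ℂ) := fun k => convexHull ℝ (f '' Ici k) with hC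
  have hCmem : ∀ k, ∀ h ∈ C k, MemLp h (ENNReal.ofReal p) μ := by
    intro k
    have : C k ⊆ {h | MemLp h (ENNReal.ofReal p) μ} := by
      refine convexHull_min ?_ ?_
      · rintro _ ⟨j, -, rfl⟩
        exact hf j
      · intro h1 m1 h2 m2 a b _ _ _
        exact (MemLp.const_smul m1 a).add (MemLp.const_smul m2 b)
    exact this
  have hCanti : ∀ {k l}, k ≤ l → C l ⊆ C k := fun {k l} hkl =>
    convexHull_mono (image_mono (Ici_subset_Ici.2 hkl))
  have hCf : ∀ k, f k ∈ C k := fun k => subset_convexHull ℝ _ ⟨k, self_mem_Ici, rfl⟩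
  -- The hulls shrink, so these infima increase, and `M` bounds them. For near-minimizers `g k`, `g
  -- l` the midpoint still lies in the larger hull, so its `N` cannot drop below `d k`; this makes
  -- the convexity defect small.
  set d : ℕ → ℝ := fun k => sInf (N '' C k) with hd
  have hbdd : ∀ k, BddBelow (N '' C k) := fun k => ⟨0, by rintro _ ⟨h, -, rfl⟩; exact hN0 h⟩
  have hd_le : ∀ k, ∀ h ∈ C k, d k ≤ N h := fun k h hh => csInf_le (hbdd k) ⟨h, hh, rfl⟩
  have hdM : ∀ k, d k ≤ M := fun k => (hd_le k _ (hCf k)).trans (hM k)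
  have hdmono : Monotone d := fun k l hkl =>
    csInf_le_csInf (hbdd k) ⟨_, f l, hCf l, rfl⟩ (image_mono (hCanti hkl))
  have hdlim : Tendsto d atTop (𝓝 (⨆ k, d k)) :=
    tendsto_atTop_ciSup hdmono ⟨M, by rintro _ ⟨k, rfl⟩; exact hdM k⟩
  have hex : ∀ k : ℕ, ∃ g ∈ C k, N g < d k + 1 / ((k : ℝ) + 1) := by
    intro k
    obtain ⟨_, ⟨g, hg, rfl⟩, h⟩ := exists_lt_of_csInf_lt (s := N '' C k) ⟨_, f k, hCf k, rfl⟩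
      (show sInf (N '' C k) < d k + 1 / ((k : ℝ) + 1) from lt_add_of_pos_right _ (by positivity))
    exact ⟨g, hg, h⟩
  choose g hgC hgN using hex
  have hgL : ∀ k, MemLp (g k) (ENNReal.ofReal p) μ := fun k => hCmem k _ (hgC k)
  have hmid : ∀ k l, k ≤ l → d k ≤ N ((1 / 2 : ℝ) • (g k + g l)) := by
    intro k l hkl
    refine hd_le k _ ?_
    have := (convex_convexHull ℝ (f '' Ici k)) (hgC k) (hCanti hkl (hgC l))
      (by norm_num : (0 : ℝ) ≤ 1 / 2) (by norm_num : (0 : ℝ) ≤ 1 / 2) (by norm_num)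
    rwa [← smul_add] at this
  have hM0 : 0 ≤ M := (hN0 _).trans (hM 0)
  have hgM : ∀ k, N (g k) ≤ M + 1 := by
    intro k
    have h1 : 1 / ((k : ℝ) + 1) ≤ 1 := by
      rw [div_le_one (by positivity)]
      have : (0 : ℝ) ≤ k := k.cast_nonneg
      linarith
    linarith [hgN k, hdM k]
  have hsub : ∀ ε > 0, ∃ K : ℕ, ∀ k ≥ K, ∀ l ≥ k, N (g k - g l) ≤ ε := by
    intro ε hε
    obtain ⟨D, hD0, hD⟩ := exists_norm_sub_rpow_le hp
      (show 0 < ε / (4 * (M + 1)) by positivity)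
    have hint : ∀ k l, N (g k - g l) ≤ ε / (4 * (M + 1)) * (N (g k) + N (g l)) +
        D * ((N (g k) + N (g l)) / 2 - N ((1 / 2 : ℝ) • (g k + g l))) := by
      intro k l
      have i1 := integrable_norm_rpow_of_memLp hp (hgL k)
      have i2 := integrable_norm_rpow_of_memLp hp (hgL l)
      have i3 := integrable_norm_rpow_of_memLp hp ((hgL k).sub (hgL l))
      have i4 := integrable_norm_rpow_of_memLp hp (((hgL k).add (hgL l)).const_smul (1 / 2 : ℝ))
      have i12 : Integrable (fun x => ‖g k x‖ ^ p + ‖g l x‖ ^ p) μ := i1.add i2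
      have i124 : Integrable (fun x => (‖g k x‖ ^ p + ‖g l x‖ ^ p) / 2 -
          ‖((1 / 2 : ℝ) • (g k + g l)) x‖ ^ p) μ := (i12.div_const 2).sub i4
      have h := integral_mono i3 ((i12.const_mul (ε / (4 * (M + 1)))).add (i124.const_mul D))
        fun x => hD (g k x) (g l x)
      simp only [Pi.add_apply] at h
      rwa [integral_add (i12.const_mul _) (i124.const_mul _), integral_const_mul,
        integral_const_mul, integral_sub (i12.div_const 2) i4, integral_div,
        integral_add i1 i2] at h
    -- Each of `d` and the near-minimality error uses half of the allowed defect `ε / (2 * (D +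
    -- 1))`; `D + 1` guards against `D = 0`.
    have hε' : 0 < ε / (2 * (D + 1)) / 2 := by positivity
    have h1 : ∀ᶠ k in atTop, (⨆ k, d k) - ε / (2 * (D + 1)) / 2 < d k :=
      hdlim.eventually (lt_mem_nhds (by linarith))
    have h2 : ∀ᶠ k : ℕ in atTop, 1 / ((k : ℝ) + 1) < ε / (2 * (D + 1)) / 2 :=
      tendsto_one_div_add_atTop_nhds_zero_nat.eventually (gt_mem_nhds hε')
    obtain ⟨K, hK⟩ := (h1.and h2).exists_forall_of_atTop
    refine ⟨K, fun k hk l hl => (hint k l).trans ?_⟩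
    have hdl : d l ≤ ⨆ k, d k := hdmono.ge_of_tendsto hdlim l
    have hdk : d k ≤ ⨆ k, d k := hdmono.ge_of_tendsto hdlim k
    have a1 := hK k hk
    have a2 := hK l (hk.trans hl)
    have b1 : ε / (4 * (M + 1)) * (N (g k) + N (g l)) ≤ ε / 2 := by
      calc _ ≤ ε / (4 * (M + 1)) * ((M + 1) + (M + 1)) := by gcongr <;> exact hgM _
        _ = ε / 2 := by field_simp; ring
    have b2 : (N (g k) + N (g l)) / 2 - N ((1 / 2 : ℝ) • (g k + g l)) ≤ ε / (2 * (D + 1)) := by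
      have := hmid k l hl
      have := hgN k
      have := hgN l
      linarith [a1.1, a1.2, a2.1, a2.2]
    have b3 : D * ((N (g k) + N (g l)) / 2 - N ((1 / 2 : ℝ) • (g k + g l))) ≤ ε / 2 := by
      calc _ ≤ D * (ε / (2 * (D + 1))) := by gcongr
        _ ≤ (D + 1) * (ε / (2 * (D + 1))) := by gcongr; linarith
        _ = ε / 2 := by field_simp
    linarith
  have hcau : CauchySeq fun k => (hgL k).toLp (g k) := by
    rw [Metric.cauchySeq_iff']
    intro ε hε
    obtain ⟨K, hK⟩ := hsub ((ε / 2) ^ p) (by positivity)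
    refine ⟨K, fun k hk => ?_⟩
    rw [dist_comm, Lp.dist_def, eLpNorm_congr_ae ((hgL K).coeFn_toLp.sub (hgL k).coeFn_toLp),
      eLpNorm_ofReal_eq hp ((hgL K).sub (hgL k)), ENNReal.toReal_ofReal (by positivity)]
    have h1 : (N (g K - g k)) ^ p⁻¹ ≤ ((ε / 2) ^ p) ^ p⁻¹ :=
      Real.rpow_le_rpow (hN0 _) (hK K le_rfl k hk) (by positivity)
    rw [Real.rpow_rpow_inv (by positivity) hp0.ne'] at h1
    exact h1.trans_lt (by linarith)
  obtain ⟨G, hG⟩ := cauchySeq_tendsto_of_complete hcau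
  refine ⟨g, G, hgC, hgL, Lp.memLp G, ?_⟩
  rw [Lp.tendsto_Lp_iff_tendsto_eLpNorm'] at hG
  refine hG.congr fun k => eLpNorm_congr_ae ?_
  exact (hgL k).coeFn_toLp.sub (ae_eq_refl _)

end LpSequences

/-! ### The Poisson kernel and the Poisson formula in the half plane -/

lemma poisson_pos {t : ℝ} (ht : 0 < t) (s : ℝ) : 0 < poisson t s := by
  have : 0 < t ^ 2 + s ^ 2 := by positivity
  unfold poisson
  positivity

lemma poisson_le {t : ℝ} (ht : 0 < t) (s : ℝ) : poisson t s ≤ 1 / (Real.pi * t) := by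
  have : 0 < t ^ 2 + s ^ 2 := by positivity
  have h : t / (t ^ 2 + s ^ 2) ≤ 1 / t := by
    rw [div_le_div_iff₀ this ht]
    nlinarith [sq_nonneg s]
  calc poisson t s ≤ 1 / Real.pi * (1 / t) := by unfold poisson; gcongr
    _ = _ := by rw [one_div_mul_one_div]

lemma continuous_poisson {t : ℝ} (ht : 0 < t) : Continuous (poisson t) := by
  have : ∀ s : ℝ, t ^ 2 + s ^ 2 ≠ 0 := fun s => by positivity
  unfold poisson
  fun_prop (disch := assumption)

lemma poisson_neg (t s : ℝ) : poisson t (-s) = poisson t s := by simp [poisson]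

lemma poisson_eq {t : ℝ} (ht : 0 < t) :
    poisson t = fun s => (Real.pi * t)⁻¹ * (1 + (s / t) ^ 2)⁻¹ := by
  ext s
  have : t ^ 2 + s ^ 2 ≠ 0 := by positivity
  have : 1 + (s / t) ^ 2 ≠ 0 := by positivity
  have := ht.ne'
  unfold poisson
  field_simp

lemma integrable_poisson {t : ℝ} (ht : 0 < t) : Integrable (poisson t) := by
  rw [poisson_eq ht]
  exact (integrable_inv_one_add_sq.comp_div ht.ne').const_mul _

lemma integral_poisson {t : ℝ} (ht : 0 < t) : ∫ s, poisson t s = 1 := by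
  rw [poisson_eq ht, integral_const_mul,
    Measure.integral_comp_div (fun s : ℝ => (1 + s ^ 2)⁻¹), integral_univ_inv_one_add_sq,
    abs_of_pos ht, smul_eq_mul]
  field_simp

lemma lintegral_poisson {t : ℝ} (ht : 0 < t) : ∫⁻ s, ENNReal.ofReal (poisson t s) = 1 := by
  rw [← ofReal_integral_eq_lintegral_ofReal (integrable_poisson ht)
    (Eventually.of_forall fun s => (poisson_pos ht s).le), integral_poisson ht, ENNReal.ofReal_one]

/-- The principal value over the real line of the difference quotient of a bounded holomorphic
function against the Poisson denominator vanishes. -/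
lemma tendsto_integral_sub_div_sq_add_sq {g : ℂ → ℂ} {M t : ℝ} (ht : 0 < t)
    (hd : DifferentiableOn ℂ g {z | 0 ≤ z.im}) (hM : ∀ z : ℂ, 0 ≤ z.im → ‖g z‖ ≤ M) :
    Tendsto (fun R : ℝ => ∫ x in (-R)..R, (g x - g (t * Complex.I)) / ((x : ℂ) ^ 2 + (t : ℂ) ^ 2))
      atTop (𝓝 0) := by
  set c : ℂ := t * Complex.I with hc
  have hcim : c.im = t := by simp [hc]
  have hM0 : 0 ≤ M := (norm_nonneg _).trans (hM c (by rw [hcim]; exact ht.le))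
  set S : Set ℂ := {z | 0 ≤ z.im} with hS
  have hSc : S ∈ 𝓝 c := by
    refine mem_of_superset ((isOpen_lt continuous_const Complex.continuous_im).mem_nhds
      (show (0 : ℝ) < c.im by rw [hcim]; exact ht)) fun z hz => (show (0 : ℝ) < z.im from hz).le
  have hne : ∀ z ∈ S, z + c ≠ 0 := by
    intro z hz h
    have := congrArg Complex.im h
    simp only [Complex.add_im, hcim, Complex.zero_im] at this
    have : (0 : ℝ) ≤ z.im := hz
    linarith
  -- Since `z² + t² = (z - c)(z + c)`, the only singularity of the quotient in the closed half plane
  -- is at `c`, and `dslope` removes it.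
  set G : ℂ → ℂ := fun z => dslope g c z / (z + c) with hG
  have hGd : DifferentiableOn ℂ G S :=
    ((Complex.differentiableOn_dslope hSc).2 hd).div
      (differentiable_id.add_const c).differentiableOn hne
  have hGeq : ∀ z, z ≠ c → G z = (g z - g c) / (z ^ 2 + (t : ℂ) ^ 2) := by
    intro z hz
    have e : z ^ 2 + (t : ℂ) ^ 2 = (z - c) * (z + c) := by
      rw [hc]; ring_nf; rw [Complex.I_sq]; ring
    rw [hG, e]
    simp only
    rw [dslope_of_ne _ hz, slope_def_field, div_div]
  -- Quadratic decay beats the total length `4R` of the three sides of the rectangle off the real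
  -- axis.
  have hbound : ∀ R : ℝ, 2 * t ≤ R → ∀ z ∈ S, R ≤ ‖z‖ → ‖G z‖ ≤ 4 * M / R ^ 2 := by
    intro R hR z hz hzR
    have hzc : z ≠ c := by
      rintro rfl
      have : ‖c‖ = t := by simp [hc, abs_of_pos ht]
      linarith
    have h1 : R ^ 2 / 2 ≤ ‖z ^ 2 + (t : ℂ) ^ 2‖ := by
      have h2 := norm_sub_le_norm_add (z ^ 2) ((t : ℂ) ^ 2)
      have h3 : ‖(t : ℂ) ^ 2‖ = t ^ 2 := by simp [abs_of_pos ht]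
      rw [h3, norm_pow] at h2
      nlinarith
    rw [hGeq z hzc, norm_div]
    have h4 : ‖g z - g c‖ ≤ 2 * M := by
      have := norm_sub_le (g z) (g c)
      have := hM z hz
      have := hM c (by rw [hcim]; exact ht.le)
      linarith
    have hR0 : 0 < R := by linarith
    calc ‖g z - g c‖ / ‖z ^ 2 + (t : ℂ) ^ 2‖ ≤ 2 * M / (R ^ 2 / 2) := by gcongr
      _ = _ := by field_simp; ring
  have hmain : ∀ R : ℝ, 2 * t ≤ R →
      ‖∫ x in (-R)..R, (g x - g c) / ((x : ℂ) ^ 2 + (t : ℂ) ^ 2)‖ ≤ 16 * M / R := by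
    intro R hR
    have hR0 : 0 < R := by linarith
    have hrect := Complex.integral_boundary_rect_eq_zero_of_differentiableOn G (-R : ℝ)
      ((R : ℝ) + (R : ℝ) * Complex.I) (hGd.mono (by
        rintro z ⟨-, hz⟩
        simp only [mem_preimage, Complex.ofReal_im, Complex.add_im, Complex.mul_im,
          Complex.ofReal_re, Complex.I_im, Complex.I_re, mul_one, mul_zero, add_zero, zero_add,
          uIcc_of_le hR0.le] at hz
        exact hz.1))
    simp only [Complex.ofReal_im, Complex.add_im, Complex.mul_im, Complex.add_re, Complex.mul_re,
      Complex.ofReal_re, Complex.I_im, Complex.I_re, mul_one, mul_zero, add_zero, zero_add,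
      sub_zero, Complex.ofReal_zero, zero_mul, smul_eq_mul] at hrect
    have e : ∫ x in (-R)..R, (g x - g c) / ((x : ℂ) ^ 2 + (t : ℂ) ^ 2) =
        ∫ x in (-R)..R, G x := by
      refine intervalIntegral.integral_congr fun x _ => ?_
      refine (hGeq x fun h => ?_).symm
      have := congrArg Complex.im h
      rw [hcim, Complex.ofReal_im] at this
      linarith
    have b1 : ‖∫ x in (-R)..R, G (x + R * Complex.I)‖ ≤ 4 * M / R ^ 2 * |R - -R| := by
      refine intervalIntegral.norm_integral_le_of_norm_le_const fun x _ => ?_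
      refine hbound R hR _ (by simp [hS, hR0.le]) ?_
      have := Complex.abs_im_le_norm ((x : ℂ) + R * Complex.I)
      simpa [abs_of_pos hR0] using this
    have b2 : ‖∫ y in (0 : ℝ)..R, G (R + y * Complex.I)‖ ≤ 4 * M / R ^ 2 * |R - 0| := by
      refine intervalIntegral.norm_integral_le_of_norm_le_const fun y hy => ?_
      rw [uIoc_of_le hR0.le] at hy
      refine hbound R hR _ (by simp [hS, hy.1.le]) ?_
      have := Complex.abs_re_le_norm ((R : ℂ) + y * Complex.I)
      simpa [abs_of_pos hR0] using this
    have b3 : ‖∫ y in (0 : ℝ)..R, G ((-R : ℝ) + y * Complex.I)‖ ≤ 4 * M / R ^ 2 * |R - 0| := by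
      refine intervalIntegral.norm_integral_le_of_norm_le_const fun y hy => ?_
      rw [uIoc_of_le hR0.le] at hy
      refine hbound R hR _ (by simp [hS, hy.1.le]) ?_
      have := Complex.abs_re_le_norm (((-R : ℝ) : ℂ) + y * Complex.I)
      simpa [abs_of_pos hR0] using this
    have hR2 : |R - -R| = 2 * R := by rw [abs_of_pos (by linarith)]; ring
    rw [hR2] at b1
    rw [sub_zero, abs_of_pos hR0] at b2 b3
    have e2 : ∫ x in (-R)..R, G x = (∫ x in (-R)..R, G (x + R * Complex.I)) -
        Complex.I * (∫ y in (0 : ℝ)..R, G (R + y * Complex.I)) +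
        Complex.I * (∫ y in (0 : ℝ)..R, G ((-R : ℝ) + y * Complex.I)) := by
      linear_combination hrect
    rw [e, e2]
    refine (norm_add_le _ _).trans ((add_le_add_left (norm_sub_le _ _) _).trans ?_)
    rw [norm_mul, norm_mul, Complex.norm_I, one_mul, one_mul]
    have : 4 * M / R ^ 2 * (2 * R) + 4 * M / R ^ 2 * R + 4 * M / R ^ 2 * R = 16 * M / R := by
      field_simp; ring
    linarith
  refine squeeze_zero_norm' ((eventually_ge_atTop (2 * t)).mono hmain) ?_
  exact tendsto_const_nhds.div_atTop tendsto_id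

lemma integrable_mul_poisson {h : ℝ → ℂ} {M t : ℝ} (ht : 0 < t) (hh : AEStronglyMeasurable h)
    (hM : ∀ x, ‖h x‖ ≤ M) : Integrable fun s => h s * (poisson t s : ℂ) :=
  (integrable_poisson ht).ofReal.bdd_mul hh (Eventually.of_forall hM)

/-- The Poisson formula for bounded holomorphic functions on the closed upper half plane. -/
theorem integral_mul_poisson_eq {g : ℂ → ℂ} {M t : ℝ} (ht : 0 < t)
    (hd : DifferentiableOn ℂ g {z | 0 ≤ z.im}) (hM : ∀ z : ℂ, 0 ≤ z.im → ‖g z‖ ≤ M) :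
    ∫ s : ℝ, g (-s : ℝ) * (poisson t s : ℂ) = g (t * Complex.I) := by
  set c : ℂ := t * Complex.I with hc
  have hcont : Continuous fun x : ℝ => g x := by
    refine hd.continuousOn.comp_continuous Complex.continuous_ofReal fun x => ?_
    simp
  have i1 : Integrable fun s : ℝ => g s * (poisson t s : ℂ) :=
    integrable_mul_poisson ht hcont.aestronglyMeasurable fun x => hM x (by simp)
  have i2 : Integrable fun s : ℝ => g c * (poisson t s : ℂ) :=
    (integrable_poisson ht).ofReal.const_mul _
  have e : ∀ x : ℝ, g x * (poisson t x : ℂ) - g c * (poisson t x : ℂ) =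
      (t / Real.pi : ℂ) * ((g x - g c) / ((x : ℂ) ^ 2 + (t : ℂ) ^ 2)) := by
    intro x
    simp only [poisson]
    push_cast
    rw [add_comm ((x : ℂ) ^ 2)]
    ring
  have h1 := intervalIntegral_tendsto_integral (i1.sub i2) tendsto_neg_atTop_atBot tendsto_id
  have h2 := (tendsto_integral_sub_div_sq_add_sq ht hd hM).const_mul (t / Real.pi : ℂ)
  simp only [← intervalIntegral.integral_const_mul, mul_zero, ← hc, ← e] at h2
  have h3 := tendsto_nhds_unique h1 h2
  simp only [Pi.sub_apply] at h3
  rw [integral_sub i1 i2, integral_const_mul, integral_complex_ofReal, integral_poisson ht,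
    Complex.ofReal_one, mul_one, sub_eq_zero] at h3
  -- The kernel is even, so reflecting the variable gives the sign used in a convolution.
  rw [← h3, ← integral_neg_eq_self]
  simp only [poisson_neg, neg_neg]

/-! ### The tube domain and pointwise bounds for functions with bounded Hardy norm -/

section Tube

variable {n : ℕ}

lemma cpoint_add_smul (x y u v : EuclideanSpace ℝ (Fin n)) (ζ : ℂ) :
    cpoint x y + ζ • cpoint u v =
      cpoint (x + (ζ.re • u - ζ.im • v)) (y + (ζ.im • u + ζ.re • v)) := by
  ext k
  simp only [cpoint, PiLp.add_apply, PiLp.smul_apply, PiLp.sub_apply, smul_eq_mul]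
  apply Complex.ext
  · simp
  · simp [add_comm]

lemma continuous_cpoint :
    Continuous fun w : EuclideanSpace ℝ (Fin n) × EuclideanSpace ℝ (Fin n) =>
      cpoint w.1 w.2 := by
  unfold cpoint
  fun_prop

lemma cpoint_mem_tube {Ω : Set (EuclideanSpace ℝ (Fin n))} (x : EuclideanSpace ℝ (Fin n))
    {y : EuclideanSpace ℝ (Fin n)} (hy : y ∈ Ω) : cpoint x y ∈ tube Ω :=
  ⟨x, y, hy, rfl⟩

/-- Rotation by the angle `θ` of pairs of vectors, i.e. multiplication by `e^{iθ}`. -/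
noncomputable def pairRotation (n : ℕ) (θ : ℝ) :
    WithLp 2 (EuclideanSpace ℝ (Fin n) × EuclideanSpace ℝ (Fin n)) →ₗᵢ[ℝ]
      WithLp 2 (EuclideanSpace ℝ (Fin n) × EuclideanSpace ℝ (Fin n)) where
  toFun w := WithLp.toLp 2 (Real.cos θ • w.fst - Real.sin θ • w.snd,
    Real.sin θ • w.fst + Real.cos θ • w.snd)
  map_add' a b := by
    refine WithLp.ofLp_injective 2 (Prod.ext ?_ ?_) <;>
    simp only [WithLp.add_fst, WithLp.add_snd, WithLp.ofLp_add, Prod.fst_add, Prod.snd_add] <;>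
    module
  map_smul' c a := by
    refine WithLp.ofLp_injective 2 (Prod.ext ?_ ?_) <;>
    simp only [WithLp.smul_fst, WithLp.smul_snd, WithLp.ofLp_smul, Prod.smul_fst, Prod.smul_snd,
      RingHom.id_apply] <;>
    module
  norm_map' w := by
    rw [← sq_eq_sq₀ (norm_nonneg _) (norm_nonneg _), WithLp.prod_norm_sq_eq_of_L2,
      WithLp.prod_norm_sq_eq_of_L2]
    change ‖Real.cos θ • w.fst - Real.sin θ • w.snd‖ ^ 2 +
      ‖Real.sin θ • w.fst + Real.cos θ • w.snd‖ ^ 2 = _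
    simp only [norm_add_sq_real, norm_sub_sq_real, norm_smul,
      inner_smul_left, inner_smul_right, mul_pow, Real.norm_eq_abs, sq_abs, conj_trivial]
    linear_combination (‖w.fst‖ ^ 2 + ‖w.snd‖ ^ 2) * Real.sin_sq_add_cos_sq θ

lemma measurePreserving_pairRotation (θ : ℝ) : MeasurePreserving (pairRotation n θ) := by
  have := ((pairRotation n θ).toLinearIsometryEquiv rfl).measurePreserving
  rwa [LinearIsometry.coe_toLinearIsometryEquiv] at this

lemma cpoint_add_circleMap_smul (x y : EuclideanSpace ℝ (Fin n))
    (w : WithLp 2 (EuclideanSpace ℝ (Fin n) × EuclideanSpace ℝ (Fin n))) (θ : ℝ) :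
    cpoint x y + circleMap 0 1 θ • cpoint w.fst w.snd =
      cpoint (x + (pairRotation n θ w).fst) (y + (pairRotation n θ w).snd) := by
  rw [cpoint_add_smul]
  have h1 : (circleMap 0 1 θ).re = Real.cos θ := by
    simp [circleMap, Complex.exp_ofReal_mul_I_re]
  have h2 : (circleMap 0 1 θ).im = Real.sin θ := by
    simp [circleMap, Complex.exp_ofReal_mul_I_im]
  rw [h1, h2]
  rfl

lemma norm_im_smul_add_re_smul_le (ζ : ℂ) (hζ : ‖ζ‖ ≤ 1)
    (w : WithLp 2 (EuclideanSpace ℝ (Fin n) × EuclideanSpace ℝ (Fin n))) :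
    ‖ζ.im • w.fst + ζ.re • w.snd‖ ≤ ‖w‖ := by
  refine (norm_add_le _ _).trans ?_
  rw [norm_smul, norm_smul, Real.norm_eq_abs, Real.norm_eq_abs]
  refine abs_le_of_sq_le_sq' ?_ (norm_nonneg _) |>.2
  rw [WithLp.prod_norm_sq_eq_of_L2]
  have h : |ζ.re| ^ 2 + |ζ.im| ^ 2 ≤ 1 := by
    rw [sq_abs, sq_abs]
    have h1 : ‖ζ‖ ^ 2 = ζ.re ^ 2 + ζ.im ^ 2 := by
      rw [Complex.sq_norm, Complex.normSq_apply]; ring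
    have h2 : ‖ζ‖ ^ 2 ≤ 1 := by
      have := norm_nonneg ζ
      nlinarith
    linarith
  have h3 := mul_le_mul_of_nonneg_right h
    (by positivity : 0 ≤ ‖w.fst‖ ^ 2 + ‖w.snd‖ ^ 2)
  nlinarith [sq_nonneg (|ζ.im| * ‖w.snd‖ - |ζ.re| * ‖w.fst‖)]

/-- This is the mean value property on the complex disc through `x + iy` in direction `w`. By
Cauchy–Schwarz imaginary parts move by at most `‖w‖ < r`, so the disc stays in the tube. -/
lemma circle_mean_enorm_le {Ω : Set (EuclideanSpace ℝ (Fin n))} {F : EuclideanSpace ℂ (Fin n) → ℂ}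
    (hF : DifferentiableOn ℂ F (tube Ω)) {r : ℝ} {x y : EuclideanSpace ℝ (Fin n)}
    (hy : Metric.ball y r ⊆ Ω)
    {w : WithLp 2 (EuclideanSpace ℝ (Fin n) × EuclideanSpace ℝ (Fin n))} (hw : ‖w‖ < r) :
    ‖F (cpoint x y)‖ₑ * ENNReal.ofReal (2 * Real.pi) ≤ ∫⁻ θ in Ioc 0 (2 * Real.pi),
      ‖F (cpoint (x + (pairRotation n θ w).fst) (y + (pairRotation n θ w).snd))‖ₑ := by
  set f : ℂ → ℂ := fun ζ => F (cpoint x y + ζ • cpoint w.fst w.snd) with hf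
  have hmaps : MapsTo (fun ζ : ℂ => cpoint x y + ζ • cpoint w.fst w.snd)
      (Metric.closedBall 0 1) (tube Ω) := by
    intro ζ hζ
    simp only
    rw [cpoint_add_smul]
    refine cpoint_mem_tube _ (hy ?_)
    rw [mem_ball_iff_norm, add_sub_cancel_left]
    exact (norm_im_smul_add_re_smul_le ζ (mem_closedBall_zero_iff.1 hζ) w).trans_lt hw
  have hfd : DifferentiableOn ℂ f (Metric.closedBall 0 1) :=
    hF.comp (by fun_prop) hmaps
  have hmean := DiffContOnCl.circleAverage (f := f) (c := 0) (R := 1) (by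
    rw [abs_one]
    exact (hfd.mono Metric.closure_ball_subset_closedBall).diffContOnCl)
  have hf0 : f 0 = F (cpoint x y) := by simp [hf]
  have e1 : F (cpoint x y) * (2 * Real.pi : ℝ) =
      ∫ θ in Ioc 0 (2 * Real.pi), f (circleMap 0 1 θ) := by
    rw [← hf0, ← hmean, Real.circleAverage_def, intervalIntegral.integral_of_le Real.two_pi_pos.le,
      Complex.real_smul, mul_comm, ← mul_assoc, ← Complex.ofReal_mul,
      mul_inv_cancel₀ Real.two_pi_pos.ne', Complex.ofReal_one, one_mul]
  calc ‖F (cpoint x y)‖ₑ * ENNReal.ofReal (2 * Real.pi)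
      = ‖F (cpoint x y) * (2 * Real.pi : ℝ)‖ₑ := by
        rw [enorm_mul, ← ofReal_norm ((2 * Real.pi : ℝ) : ℂ), Complex.norm_real,
          Real.norm_of_nonneg Real.two_pi_pos.le]
    _ ≤ ∫⁻ θ in Ioc 0 (2 * Real.pi), ‖f (circleMap 0 1 θ)‖ₑ := by
        rw [e1]; exact enorm_integral_le_lintegral_enorm _
    _ = _ := by simp only [hf, cpoint_add_circleMap_smul]

lemma continuous_pairRotation : Continuous fun q : ℝ × WithLp 2 (EuclideanSpace ℝ (Fin n) ×
    EuclideanSpace ℝ (Fin n)) => pairRotation n q.1 q.2 := by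
  have h1 : Continuous fun q : ℝ × WithLp 2 (EuclideanSpace ℝ (Fin n) ×
    EuclideanSpace ℝ (Fin n)) => q.2.fst := by fun_prop
  have h2 : Continuous fun q : ℝ × WithLp 2 (EuclideanSpace ℝ (Fin n) ×
    EuclideanSpace ℝ (Fin n)) => q.2.snd := by fun_prop
  change Continuous fun q : ℝ × WithLp 2 (EuclideanSpace ℝ (Fin n) ×
    EuclideanSpace ℝ (Fin n)) => WithLp.toLp 2 (Real.cos q.1 • q.2.fst - Real.sin q.1 • q.2.snd,
      Real.sin q.1 • q.2.fst + Real.cos q.1 • q.2.snd)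
  fun_prop

/-- A crude substitute for Jensen: the constant `1` is harmless on a ball of finite volume. -/
lemma le_one_add_rpow {p : ℝ} (hp : 1 < p) (a : ℝ≥0∞) : a ≤ 1 + a ^ p := by
  rcases le_total a 1 with h | h
  · exact h.trans le_self_add
  · calc a = a ^ (1 : ℝ) := (ENNReal.rpow_one a).symm
      _ ≤ a ^ p := ENNReal.rpow_le_rpow_of_exponent_le h hp.le
      _ ≤ _ := le_add_self

/-- The sub-mean value inequality over balls of pairs of vectors. -/
lemma enorm_mul_volume_ball_le {Ω : Set (EuclideanSpace ℝ (Fin n))}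
    {F : EuclideanSpace ℂ (Fin n) → ℂ} (hF : DifferentiableOn ℂ F (tube Ω)) {r : ℝ}
    {x y : EuclideanSpace ℝ (Fin n)} (hy : Metric.ball y r ⊆ Ω)
    {H : WithLp 2 (EuclideanSpace ℝ (Fin n) × EuclideanSpace ℝ (Fin n)) → ℝ≥0∞} (hH : Measurable H)
    (hFH : ∀ w, ‖w‖ < r → ‖F (cpoint (x + w.fst) (y + w.snd))‖ₑ ≤ H w) :
    ‖F (cpoint x y)‖ₑ * volume (Metric.ball (0 : WithLp 2 (EuclideanSpace ℝ (Fin n) ×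
      EuclideanSpace ℝ (Fin n))) r) ≤ ∫⁻ w, H w := by
  set B := Metric.ball (0 : WithLp 2 (EuclideanSpace ℝ (Fin n) × EuclideanSpace ℝ (Fin n))) r
  have hpi : ENNReal.ofReal (2 * Real.pi) ≠ 0 := by
    simpa using Real.pi_pos
  have hmeas : Measurable fun q : ℝ × WithLp 2 (EuclideanSpace ℝ (Fin n) ×
    EuclideanSpace ℝ (Fin n)) => H (pairRotation n q.1 q.2) :=
    hH.comp continuous_pairRotation.measurable
  -- Average the circle inequality over `w ∈ B` and exchange integrals: rotations preserve volume,
  -- so the inner integral does not depend on `θ`.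
  have key : (‖F (cpoint x y)‖ₑ * volume B) * ENNReal.ofReal (2 * Real.pi) ≤
      (∫⁻ w, H w) * ENNReal.ofReal (2 * Real.pi) := by
    calc (‖F (cpoint x y)‖ₑ * volume B) * ENNReal.ofReal (2 * Real.pi)
        = ∫⁻ w in B, ‖F (cpoint x y)‖ₑ * ENNReal.ofReal (2 * Real.pi) := by
          rw [setLIntegral_const]; ring
      _ ≤ ∫⁻ w in B, ∫⁻ θ in Ioc 0 (2 * Real.pi), H (pairRotation n θ w) := by
          refine setLIntegral_mono' Metric.isOpen_ball.measurableSet fun w hw => ?_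
          have hw' : ‖w‖ < r := mem_ball_zero_iff.1 hw
          refine (circle_mean_enorm_le hF hy hw').trans (lintegral_mono fun θ => ?_)
          exact hFH _ (by rwa [LinearIsometry.norm_map])
      _ ≤ ∫⁻ w, ∫⁻ θ in Ioc 0 (2 * Real.pi), H (pairRotation n θ w) := setLIntegral_le_lintegral _ _
      _ = ∫⁻ θ in Ioc 0 (2 * Real.pi), ∫⁻ w, H (pairRotation n θ w) := by
          rw [lintegral_lintegral_swap]
          exact (hmeas.comp measurable_swap).aemeasurable
      _ = ∫⁻ θ in Ioc 0 (2 * Real.pi), ∫⁻ w, H w := by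
          refine lintegral_congr fun θ => ?_
          exact (measurePreserving_pairRotation θ).lintegral_comp hH
      _ = _ := by rw [setLIntegral_const, Real.volume_Ioc, sub_zero]
  exact (ENNReal.mul_le_mul_iff_left hpi ENNReal.ofReal_ne_top).1 key

/-- Functions with uniformly bounded `L^p` norms on horizontal slices are bounded away from the
boundary of the tube. -/
theorem exists_norm_le_of_lintegral_le {Ω : Set (EuclideanSpace ℝ (Fin n))}
    {F : EuclideanSpace ℂ (Fin n) → ℂ} (hF : DifferentiableOn ℂ F (tube Ω)) {p : ℝ} (hp : 1 < p)
    {N : ℝ≥0∞} (hN : N < ∞)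
    (hFN : ∀ y ∈ Ω, ∫⁻ x : EuclideanSpace ℝ (Fin n), ‖F (cpoint x y)‖ₑ ^ p ≤ N)
    {r : ℝ} (hr : 0 < r) :
    ∃ M : ℝ, ∀ x y, Metric.ball y r ⊆ Ω → ‖F (cpoint x y)‖ ≤ M := by
  set B := Metric.ball (0 : WithLp 2 (EuclideanSpace ℝ (Fin n) × EuclideanSpace ℝ (Fin n))) r
    with hB
  set b := Metric.ball (0 : EuclideanSpace ℝ (Fin n)) r with hb
  have hBpos : volume B ≠ 0 := (Metric.measure_ball_pos volume _ hr).ne'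
  have hBfin : volume B ≠ ∞ := measure_ball_lt_top.ne
  have hbfin : volume b ≠ ∞ := measure_ball_lt_top.ne
  set K : ℝ≥0∞ := (volume B + volume b * N) / volume B with hK
  have hKfin : K ≠ ∞ :=
    ENNReal.div_ne_top (ENNReal.add_ne_top.2 ⟨hBfin, ENNReal.mul_ne_top hbfin hN.ne⟩) hBpos
  refine ⟨K.toReal, fun x y hy => ?_⟩
  suffices h : ‖F (cpoint x y)‖ₑ ≤ K by
    have := ENNReal.toReal_mono hKfin h
    rwa [toReal_enorm] at this
  rw [hK, ENNReal.le_div_iff_mul_le (Or.inl hBpos) (Or.inl hBfin)]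
  set V : Set (EuclideanSpace ℝ (Fin n) × EuclideanSpace ℝ (Fin n)) := univ ×ˢ b with hV
  have hVm : MeasurableSet V := MeasurableSet.univ.prod Metric.isOpen_ball.measurableSet
  have hcont : ContinuousOn (fun q : EuclideanSpace ℝ (Fin n) × EuclideanSpace ℝ (Fin n) =>
      F (cpoint (x + q.1) (y + q.2))) V := by
    refine hF.continuousOn.comp (continuous_cpoint.comp (f := fun q : EuclideanSpace ℝ (Fin n) ×
      EuclideanSpace ℝ (Fin n) => (x + q.1, y + q.2)) (by fun_prop)).continuousOn ?_
    rintro q ⟨-, hq⟩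
    refine cpoint_mem_tube _ (hy ?_)
    rwa [mem_ball_iff_norm, add_sub_cancel_left, ← mem_ball_zero_iff]
  -- Only imaginary shifts are confined to the ball; real shifts run over all of `ℝ^n`, so each
  -- inner integral is a full slice bounded by `N`. Truncating to `V` gives measurability, as `F` is
  -- arbitrary off the tube.
  set J : EuclideanSpace ℝ (Fin n) × EuclideanSpace ℝ (Fin n) → ℝ≥0∞ :=
    V.indicator fun q => ‖F (cpoint (x + q.1) (y + q.2))‖ₑ ^ p with hJ
  have hJm : Measurable J := by
    classical
    have h1 : Measurable (V.piecewise (fun q => F (cpoint (x + q.1) (y + q.2))) fun _ => 0) :=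
      hcont.measurable_piecewise continuousOn_const hVm
    have h2 : J = fun q =>
        ‖V.piecewise (fun q => F (cpoint (x + q.1) (y + q.2))) (fun _ => 0) q‖ₑ ^ p := by
      ext q
      by_cases hq : q ∈ V
      · simp [hJ, hq]
      · simp [hJ, hq, show 0 < p by linarith]
    rw [h2]
    exact h1.enorm.pow_const p
  have hJint : ∫⁻ q, J q ≤ volume b * N := by
    rw [Measure.volume_eq_prod, lintegral_prod_symm _ hJm.aemeasurable]
    calc ∫⁻ v, ∫⁻ u, J (u, v) ≤ ∫⁻ v, b.indicator (fun _ => N) v := by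
          refine lintegral_mono fun v => ?_
          by_cases hv : v ∈ b
          · simp only [hJ, hV, hv, indicator, mem_prod, mem_univ, true_and, if_true]
            rw [lintegral_add_left_eq_self (fun u => ‖F (cpoint u (y + v))‖ₑ ^ p)]
            refine hFN _ (hy ?_)
            rwa [mem_ball_iff_norm, add_sub_cancel_left, ← mem_ball_zero_iff]
          · simp [hJ, hV, hv, indicator]
      _ = _ := by rw [lintegral_indicator_const Metric.isOpen_ball.measurableSet, mul_comm]
  set H : WithLp 2 (EuclideanSpace ℝ (Fin n) × EuclideanSpace ℝ (Fin n)) → ℝ≥0∞ :=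
    fun w => B.indicator (fun _ => 1) w + J (WithLp.ofLp w) with hH
  have hofLp := WithLp.volume_preserving_ofLp (U := EuclideanSpace ℝ (Fin n))
    (V := EuclideanSpace ℝ (Fin n))
  have hJm' : Measurable fun w : WithLp 2 (EuclideanSpace ℝ (Fin n) ×
      EuclideanSpace ℝ (Fin n)) => J (WithLp.ofLp w) := hJm.comp hofLp.measurable
  have hHm : Measurable H :=
    (measurable_const.indicator Metric.isOpen_ball.measurableSet).add hJm'
  refine (enorm_mul_volume_ball_le hF hy hHm fun w hw => ?_).trans ?_
  · have h1 : w ∈ B := mem_ball_zero_iff.2 hw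
    have h2 : WithLp.ofLp w ∈ V := by
      refine ⟨mem_univ _, mem_ball_zero_iff.2 (lt_of_le_of_lt ?_ hw)⟩
      have := norm_im_smul_add_re_smul_le (1 : ℂ) (by simp) w
      simpa using this
    simp only [hH, hJ, indicator_of_mem h1, indicator_of_mem h2]
    exact le_one_add_rpow hp _
  · rw [hH, lintegral_add_right _ hJm', lintegral_indicator_const Metric.isOpen_ball.measurableSet,
      one_mul, hofLp.lintegral_comp hJm]
    gcongr

end Tube

/-! ### Iterated Poisson integrals as integrals over `ℝ^m` -/

section Snoc

variable {m : ℕ}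

lemma measurePreserving_snoc :
    MeasurePreserving (fun q : ℝ × (Fin m → ℝ) => (Fin.snoc q.2 q.1 : Fin (m + 1) → ℝ)) := by
  have h := (volume_preserving_piFinSuccAbove (fun _ : Fin (m + 1) => ℝ) (Fin.last m)).symm
  convert h using 1
  ext q j
  simp [MeasurableEquiv.piFinSuccAbove]

lemma measurableEmbedding_snoc :
    MeasurableEmbedding (fun q : ℝ × (Fin m → ℝ) => (Fin.snoc q.2 q.1 : Fin (m + 1) → ℝ)) := by
  have h := (MeasurableEquiv.piFinSuccAbove (fun _ : Fin (m + 1) => ℝ)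
    (Fin.last m)).symm.measurableEmbedding
  convert h using 1
  ext q j
  simp [MeasurableEquiv.piFinSuccAbove]

end Snoc

section Iterated

variable {n m : ℕ}

lemma proj_snoc (e : Fin (m + 1) → EuclideanSpace ℝ (Fin n)) (s : Fin m → ℝ) (a : ℝ) :
    proj e (Fin.snoc s a : Fin (m + 1) → ℝ) =
      proj (fun j => e j.castSucc) s + a • e (Fin.last m) := by
  simp [proj, Fin.sum_univ_castSucc]

lemma prod_poisson_snoc (t : Fin (m + 1) → ℝ) (s : Fin m → ℝ) (a : ℝ) :
    ∏ j, poisson (t j) ((Fin.snoc s a : Fin (m + 1) → ℝ) j) =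
      (∏ j : Fin m, poisson (t j.castSucc) (s j)) * poisson (t (Fin.last m)) a := by
  simp [Fin.prod_univ_castSucc]

lemma continuous_proj (e : Fin m → EuclideanSpace ℝ (Fin n)) : Continuous (proj e) := by
  unfold proj
  fun_prop

lemma continuous_prod_poisson {t : Fin m → ℝ} (ht : t ∈ orthant m) :
    Continuous fun s : Fin m → ℝ => ∏ j, poisson (t j) (s j) :=
  continuous_finsetProd _ fun j _ => (continuous_poisson (ht j)).comp (continuous_apply j)

lemma prod_poisson_pos {t : Fin m → ℝ} (ht : t ∈ orthant m) (s : Fin m → ℝ) :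
    0 < ∏ j, poisson (t j) (s j) :=
  Finset.prod_pos fun j _ => poisson_pos (ht j) _

lemma lintegral_prod_poisson {t : Fin m → ℝ} (ht : t ∈ orthant m) :
    ∫⁻ s : Fin m → ℝ, ENNReal.ofReal (∏ j, poisson (t j) (s j)) = 1 := by
  have hi : Integrable fun s : Fin m → ℝ => ∏ j, poisson (t j) (s j) :=
    Integrable.fintype_prod fun j => integrable_poisson (ht j)
  rw [← ofReal_integral_eq_lintegral_ofReal hi
    (Eventually.of_forall fun s => (prod_poisson_pos ht s).le),
    integral_fintype_prod_volume_eq_prod fun j => poisson (t j)]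
  simp [integral_poisson (ht _)]

/-- The image of Lebesgue measure under a linear isomorphism is a Haar measure, hence a multiple of
Lebesgue measure by uniqueness. -/
lemma exists_lintegral_comp_sub_eq (L : (Fin n → ℝ) ≃L[ℝ] EuclideanSpace ℝ (Fin n)) :
    ∃ c : ℝ≥0∞, c ≠ ∞ ∧ ∀ h : EuclideanSpace ℝ (Fin n) → ℝ≥0∞, Measurable h → ∀ x,
      ∫⁻ s, h (x - L s) = c * ∫⁻ y, h y := by
  have := L.isAddHaarMeasure_map volume
  obtain ⟨c, hmap⟩ : ∃ c : NNReal, (volume : Measure (Fin n → ℝ)).map L =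
      c • (volume : Measure (EuclideanSpace ℝ (Fin n))) :=
    ⟨_, Measure.isAddLeftInvariant_eq_smul _ _⟩
  refine ⟨c, ENNReal.coe_ne_top, fun h hh x => ?_⟩
  rw [← lintegral_map (f := fun y => h (x - y)) (hh.comp (measurable_const.sub measurable_id))
    L.continuous.measurable, hmap, lintegral_smul_measure, lintegral_sub_left_eq_self,
    ENNReal.smul_def, smul_eq_mul]

lemma exists_continuousLinearEquiv_eq_proj (e : Fin n → EuclideanSpace ℝ (Fin n))
    (he : LinearIndependent ℝ e) :
    ∃ L : (Fin n → ℝ) ≃L[ℝ] EuclideanSpace ℝ (Fin n), ∀ s, L s = proj e s := by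
  have hs : ⊤ ≤ Submodule.span ℝ (range e) :=
    (he.span_eq_top_of_card_eq_finrank' (by simp)).ge
  refine ⟨(Module.Basis.mk he hs).equivFun.symm.toContinuousLinearEquiv, fun s => ?_⟩
  simp [proj, Module.Basis.equivFun_symm_apply]

lemma linearIndependent_castSucc_embedding {e : Fin (m + 1) → EuclideanSpace ℝ (Fin n)}
    (he : ∀ σ : Fin n ↪ Fin (m + 1), LinearIndependent ℝ fun k => e (σ k)) (σ : Fin n ↪ Fin m) :
    LinearIndependent ℝ fun k => e (σ k).castSucc :=
  he (σ.trans Fin.castSuccEmb)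

/-- The iterated Poisson integral along a spanning family maps `L^1` to `L^∞`. -/
theorem exists_lintegral_prod_poisson_le (hnm : n ≤ m) :
    ∀ (e : Fin m → EuclideanSpace ℝ (Fin n)),
      (∀ σ : Fin n ↪ Fin m, LinearIndependent ℝ fun k => e (σ k)) → ∀ t ∈ orthant m,
      ∃ c : ℝ≥0∞, c ≠ ∞ ∧ ∀ h : EuclideanSpace ℝ (Fin n) → ℝ≥0∞, Measurable h → ∀ x,
        ∫⁻ s, h (x - proj e s) * ENNReal.ofReal (∏ j, poisson (t j) (s j)) ≤
          c * ∫⁻ y, h y := by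
  -- For `m = n` the vectors form a basis: bound the kernel by its maximum and change variables.
  -- Each further direction integrates against a probability density and keeps the same `c`.
  induction m, hnm using Nat.le_induction with
  | base =>
    intro e he t ht
    obtain ⟨L, hL⟩ := exists_continuousLinearEquiv_eq_proj e
      (he (Function.Embedding.refl (Fin n)))
    obtain ⟨c, hc, hcL⟩ := exists_lintegral_comp_sub_eq L
    refine ⟨c * ENNReal.ofReal (∏ j, 1 / (Real.pi * t j)),
      ENNReal.mul_ne_top hc ENNReal.ofReal_ne_top, fun h hh x => ?_⟩
    calc ∫⁻ s, h (x - proj e s) * ENNReal.ofReal (∏ j, poisson (t j) (s j))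
        ≤ ∫⁻ s, h (x - L s) * ENNReal.ofReal (∏ j, 1 / (Real.pi * t j)) := by
          refine lintegral_mono fun s => ?_
          simp only [hL]
          gcongr with j
          · exact fun j _ => (poisson_pos (ht j) _).le
          · exact poisson_le (ht j) _
      _ = c * ENNReal.ofReal (∏ j, 1 / (Real.pi * t j)) * ∫⁻ y, h y := by
          rw [lintegral_mul_const' _ _ ENNReal.ofReal_ne_top, hcL h hh x]
          ring
      _ ≤ _ := le_rfl
  | succ m hnm ih =>
    intro e he t ht
    obtain ⟨c, hc, hcI⟩ := ih (fun j => e j.castSucc) (linearIndependent_castSucc_embedding he)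
      (fun j => t j.castSucc) fun j => ht j.castSucc
    refine ⟨c, hc, fun h hh x => ?_⟩
    have hm : Measurable fun s : Fin (m + 1) → ℝ =>
        h (x - proj e s) * ENNReal.ofReal (∏ j, poisson (t j) (s j)) :=
      (hh.comp (measurable_const.sub (continuous_proj e).measurable)).mul
        (continuous_prod_poisson ht).measurable.ennreal_ofReal
    have hm' : Measurable fun q : ℝ × (Fin m → ℝ) =>
        h (x - proj e (Fin.snoc q.2 q.1 : Fin (m + 1) → ℝ)) * ENNReal.ofReal
          (∏ j, poisson (t j) ((Fin.snoc q.2 q.1 : Fin (m + 1) → ℝ) j)) :=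
      hm.comp measurePreserving_snoc.measurable
    rw [← measurePreserving_snoc.lintegral_comp hm, Measure.volume_eq_prod,
      lintegral_prod _ hm'.aemeasurable]
    calc _ ≤ ∫⁻ a, (c * ∫⁻ y, h y) * ENNReal.ofReal (poisson (t (Fin.last m)) a) := by
          refine lintegral_mono fun a => ?_
          refine le_trans (le_of_eq ?_) (mul_le_mul_left (hcI h hh (x - a • e (Fin.last m))) _)
          rw [← lintegral_mul_const' _ _ ENNReal.ofReal_ne_top]
          refine lintegral_congr fun s => ?_
          rw [proj_snoc, prod_poisson_snoc, ENNReal.ofReal_mul (prod_poisson_pos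
            (fun j => ht j.castSucc : (fun j : Fin m => t j.castSucc) ∈ orthant m) s).le,
            mul_assoc, sub_sub, add_comm (proj _ s)]
      _ = _ := by
          rw [lintegral_const_mul _ (continuous_poisson (ht _)).measurable.ennreal_ofReal,
            lintegral_poisson (ht _), mul_one]

/-- The iterated Poisson integral along a spanning family maps `L^p` to `L^∞`. -/
theorem exists_lintegral_enorm_mul_poisson_le (hnm : n ≤ m)
    {e : Fin m → EuclideanSpace ℝ (Fin n)}
    (he : ∀ σ : Fin n ↪ Fin m, LinearIndependent ℝ fun k => e (σ k)) {t : Fin m → ℝ}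
    (ht : t ∈ orthant m) {p : ℝ} (hp : 1 < p) :
    ∃ c : ℝ≥0∞, c ≠ ∞ ∧ ∀ f : EuclideanSpace ℝ (Fin n) → ℂ, Measurable f → ∀ x,
      ∫⁻ s, ‖f (x - proj e s) * ((∏ j, poisson (t j) (s j) : ℝ) : ℂ)‖ₑ ≤
        c * eLpNorm f (ENNReal.ofReal p) volume := by
  have hp0 : 0 < p := by linarith
  obtain ⟨c, hc, hcI⟩ := exists_lintegral_prod_poisson_le hnm e he t ht
  refine ⟨c ^ (1 / p), ENNReal.rpow_ne_top_of_nonneg (by positivity) hc, fun f hf x => ?_⟩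
  set W : (Fin m → ℝ) → ℝ≥0∞ := fun s => ENNReal.ofReal (∏ j, poisson (t j) (s j)) with hW
  have hWm : Measurable W := (continuous_prod_poisson ht).measurable.ennreal_ofReal
  have hg : Measurable fun s => ‖f (x - proj e s)‖ₑ :=
    (hf.comp (measurable_const.sub (continuous_proj e).measurable)).enorm
  -- `ν` is a probability measure, so Hölder against the constant `1` reduces the claim to the `L^1`
  -- bound for `|f|^p`.
  set ν : Measure (Fin m → ℝ) := volume.withDensity W with hν
  have hν1 : ν univ = 1 := by
    rw [hν, withDensity_apply _ MeasurableSet.univ, setLIntegral_univ, lintegral_prod_poisson ht]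
  have hνI : ∀ g : (Fin m → ℝ) → ℝ≥0∞, Measurable g → ∫⁻ s, g s ∂ν = ∫⁻ s, g s * W s := by
    intro g hgm
    rw [hν, lintegral_withDensity_eq_lintegral_mul _ hWm hgm]
    simp only [Pi.mul_apply, mul_comm]
  have h1 : ∫⁻ s, ‖f (x - proj e s) * ((∏ j, poisson (t j) (s j) : ℝ) : ℂ)‖ₑ =
      ∫⁻ s, ‖f (x - proj e s)‖ₑ ∂ν := by
    rw [hνI _ hg]
    refine lintegral_congr fun s => ?_
    rw [enorm_mul, ← ofReal_norm (((∏ j, poisson (t j) (s j) : ℝ)) : ℂ), Complex.norm_real,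
      Real.norm_of_nonneg (prod_poisson_pos ht s).le]
  have hpq := Real.HolderConjugate.conjExponent hp
  have h2 := ENNReal.lintegral_mul_le_Lp_mul_Lq ν hpq hg.aemeasurable
    (aemeasurable_const (b := (1 : ℝ≥0∞)))
  simp only [Pi.mul_apply, mul_one, ENNReal.one_rpow, lintegral_const, hν1] at h2
  rw [hνI _ (hg.pow_const p)] at h2
  have h3 := hcI (fun y => ‖f y‖ₑ ^ p) (hf.enorm.pow_const p) x
  rw [h1, eLpNorm_eq_lintegral_rpow_enorm_toReal (by simpa using hp0) ENNReal.ofReal_ne_top,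
    ENNReal.toReal_ofReal hp0.le, ← ENNReal.mul_rpow_of_nonneg _ _ (by positivity)]
  exact h2.trans (ENNReal.rpow_le_rpow h3 (by positivity))

lemma integrable_mul_prod_poisson (hnm : n ≤ m) {e : Fin m → EuclideanSpace ℝ (Fin n)}
    (he : ∀ σ : Fin n ↪ Fin m, LinearIndependent ℝ fun k => e (σ k)) {t : Fin m → ℝ}
    (ht : t ∈ orthant m) {p : ℝ} (hp : 1 < p) {f : EuclideanSpace ℝ (Fin n) → ℂ}
    (hfm : Measurable f) (hf : MemLp f (ENNReal.ofReal p) volume) (x : EuclideanSpace ℝ (Fin n)) :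
    Integrable fun s => f (x - proj e s) * ((∏ j, poisson (t j) (s j) : ℝ) : ℂ) := by
  obtain ⟨c, hc, h⟩ := exists_lintegral_enorm_mul_poisson_le hnm he ht hp
  refine ⟨?_, (h f hfm x).trans_lt (ENNReal.mul_lt_top hc.lt_top hf.2)⟩
  exact ((hfm.comp (measurable_const.sub (continuous_proj e).measurable)).mul
    (Complex.continuous_ofReal.comp (continuous_prod_poisson ht)).measurable).aestronglyMeasurable

/-- Fubini's theorem for the iterated Poisson integral. -/
theorem iterPoisson_eq_integral (f : EuclideanSpace ℝ (Fin n) → ℂ) :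
    ∀ (m : ℕ) (e : Fin m → EuclideanSpace ℝ (Fin n)), ∀ t ∈ orthant m, ∀ x,
      (Integrable fun s => f (x - proj e s) * ((∏ j, poisson (t j) (s j) : ℝ) : ℂ)) →
      iterPoisson e t f x = ∫ s, f (x - proj e s) * ((∏ j, poisson (t j) (s j) : ℝ) : ℂ) := by
  intro m
  induction m with
  | zero =>
    intro e t _ x _
    have : (volume : Measure (Fin 0 → ℝ)) = Measure.dirac 0 := by
      rw [volume_pi, Measure.pi_of_empty _ 0]
    rw [this]
    simp [iterPoisson, proj]
  | succ m ih =>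
    intro e t ht x hint
    have ht' : (fun j : Fin m => t j.castSucc) ∈ orthant m := fun j => ht j.castSucc
    have e1 : ∀ q : ℝ × (Fin m → ℝ), f (x - proj e (Fin.snoc q.2 q.1 : Fin (m + 1) → ℝ)) *
        ((∏ j, poisson (t j) ((Fin.snoc q.2 q.1 : Fin (m + 1) → ℝ) j) : ℝ) : ℂ) =
        f (x - q.1 • e (Fin.last m) - proj (fun j => e j.castSucc) q.2) *
          ((∏ j : Fin m, poisson (t j.castSucc) (q.2 j) : ℝ) : ℂ) *
          (poisson (t (Fin.last m)) q.1 : ℂ) := by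
      intro q
      rw [proj_snoc, prod_poisson_snoc, Complex.ofReal_mul, mul_assoc, sub_sub,
        add_comm (proj _ q.2)]
    have hint' := (measurePreserving_snoc.integrable_comp_emb measurableEmbedding_snoc).2 hint
    simp only [Function.comp_def, e1] at hint'
    rw [← measurePreserving_snoc.integral_comp measurableEmbedding_snoc]
    simp only [e1]
    rw [Measure.volume_eq_prod] at hint' ⊢
    rw [integral_prod _ hint']
    change ∫ a : ℝ, _ = _
    refine integral_congr_ae ?_
    -- The induction hypothesis is available only where the slice is integrable, i.e. for almost
    -- every `a`, which the outer integral does not notice. The nonzero factor in `a` is divided out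
    -- of the integrability statement.
    filter_upwards [hint'.prod_right_ae] with a ha
    have hpa : (poisson (t (Fin.last m)) a : ℂ) ≠ 0 :=
      Complex.ofReal_ne_zero.2 (poisson_pos (ht _) a).ne'
    rw [ih (fun j => e j.castSucc) _ ht' (x - a • e (Fin.last m))
      ((integrable_mul_const_iff hpa.isUnit _).1 ha), integral_mul_const]

end Iterated

/-! ### The Poisson representation -/

section Cone

variable {n m : ℕ}

/-- The generators span, so `proj e` is a surjective linear map, hence open. -/
lemma isOpen_cone (hnm : n ≤ m) {e : Fin m → EuclideanSpace ℝ (Fin n)}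
    (he : ∀ σ : Fin n ↪ Fin m, LinearIndependent ℝ fun k => e (σ k)) : IsOpen (cone e) := by
  have hspan : ⊤ ≤ Submodule.span ℝ (range e) := by
    rw [← (he (Fin.castLEEmb hnm)).span_eq_top_of_card_eq_finrank' (by simp)]
    exact Submodule.span_mono (range_comp_subset_range (Fin.castLEEmb hnm) e)
  set L : (Fin m → ℝ) →ₗ[ℝ] EuclideanSpace ℝ (Fin n) := Fintype.linearCombination ℝ e with hL
  have hLe : ⇑L = proj e := by
    ext1 s
    simp [hL, proj, Fintype.linearCombination_apply]
  have hsurj : Function.Surjective L := by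
    rw [← LinearMap.range_eq_top, hL, Fintype.range_linearCombination]
    exact top_le_iff.1 hspan
  have hopen : IsOpen (orthant m) := by
    simp only [orthant, ofPred_forall]
    exact isOpen_iInter_of_finite fun j => isOpen_lt continuous_const (continuous_apply j)
  rw [cone, ← hLe]
  exact L.isOpenMap_of_finiteDimensional hsurj _ hopen

lemma add_smul_mem_cone {e : Fin m → EuclideanSpace ℝ (Fin n)} (j : Fin m)
    {y : EuclideanSpace ℝ (Fin n)} (hy : y ∈ cone e) {a : ℝ} (ha : 0 ≤ a) :
    y + a • e j ∈ cone e := by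
  obtain ⟨t, ht, rfl⟩ := hy
  refine ⟨t + Pi.single j a, fun k => ?_, ?_⟩
  · have : 0 ≤ (Pi.single j a : Fin m → ℝ) k := by
      by_cases h : k = j
      · subst h; simpa using ha
      · simp [h]
    exact add_pos_of_pos_of_nonneg (ht k) this
  · simp [proj, add_smul, Finset.sum_add_distrib, Pi.single_apply]

lemma proj_mem_cone (e : Fin m → EuclideanSpace ℝ (Fin n)) {t : Fin m → ℝ} (ht : t ∈ orthant m) :
    proj e t ∈ cone e := mem_image_of_mem _ ht

end Cone

/-! ### The Poisson formula along the generators, inside the tube -/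

section Slices

variable {n : ℕ} {Ω : Set (EuclideanSpace ℝ (Fin n))} {F : EuclideanSpace ℂ (Fin n) → ℂ}
  {p : ℝ} {N : ℝ≥0∞}

/-- The Poisson formula in one direction of the tube. -/
lemma linePoisson_slice (hΩ : IsOpen Ω) (hF : DifferentiableOn ℂ F (tube Ω)) (hp : 1 < p)
    (hN : N < ∞) (hFN : ∀ y ∈ Ω, ∫⁻ x : EuclideanSpace ℝ (Fin n), ‖F (cpoint x y)‖ₑ ^ p ≤ N)
    {v : EuclideanSpace ℝ (Fin n)} (hv : ∀ y ∈ Ω, ∀ a : ℝ, 0 ≤ a → y + a • v ∈ Ω)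
    {y : EuclideanSpace ℝ (Fin n)} (hy : y ∈ Ω) {t : ℝ} (ht : 0 < t)
    (x : EuclideanSpace ℝ (Fin n)) :
    linePoisson v t (fun x => F (cpoint x y)) x = F (cpoint x (y + t • v)) := by
  obtain ⟨r, hr, hball⟩ := Metric.isOpen_iff.1 hΩ y hy
  obtain ⟨M, hM⟩ := exists_norm_le_of_lintegral_le hF hp hN hFN hr
  -- Stability of `Ω` under `a • v` carries the ball at `y` along the ray, so a single `M` bounds
  -- `F` on the whole closed half plane.
  have hball' : ∀ a : ℝ, 0 ≤ a → Metric.ball (y + a • v) r ⊆ Ω := by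
    intro a ha z hz
    have h1 : z - a • v ∈ Ω := hball (by
      rw [mem_ball_iff_norm] at hz ⊢
      rwa [sub_sub, add_comm (a • v)])
    simpa using hv _ h1 a ha
  have hline : ∀ ζ : ℂ, cpoint x y + ζ • cpoint v 0 =
      cpoint (x + ζ.re • v) (y + ζ.im • v) := by
    intro ζ
    simp [cpoint_add_smul]
  have key := integral_mul_poisson_eq (g := fun ζ => F (cpoint x y + ζ • cpoint v 0)) (M := M) ht
    (hF.comp (by fun_prop) fun ζ hζ => by
      rw [hline]
      exact cpoint_mem_tube _ (hv y hy _ hζ))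
    (fun ζ hζ => by
      rw [hline]
      exact hM _ _ (hball' _ hζ))
  simp only [hline] at key
  simpa [linePoisson, sub_eq_add_neg] using key

/-- The iterated Poisson formula inside the tube. -/
theorem iterPoisson_slice (hΩ : IsOpen Ω) (hF : DifferentiableOn ℂ F (tube Ω)) (hp : 1 < p)
    (hN : N < ∞) (hFN : ∀ y ∈ Ω, ∫⁻ x : EuclideanSpace ℝ (Fin n), ‖F (cpoint x y)‖ₑ ^ p ≤ N) :
    ∀ (m : ℕ) (e : Fin m → EuclideanSpace ℝ (Fin n)),
      (∀ j, ∀ y ∈ Ω, ∀ a : ℝ, 0 ≤ a → y + a • e j ∈ Ω) → ∀ t ∈ orthant m, ∀ y ∈ Ω,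
      y + proj e t ∈ Ω ∧
        iterPoisson e t (fun x => F (cpoint x y)) = fun x => F (cpoint x (y + proj e t)) := by
  intro m
  induction m with
  | zero =>
    intro e _ t _ y hy
    simpa [iterPoisson, proj] using hy
  | succ m ih =>
    intro e he t ht y hy
    obtain ⟨h1, h2⟩ := ih (fun j => e j.castSucc) (fun j => he j.castSucc)
      (fun j => t j.castSucc) (fun j => ht j.castSucc) y hy
    have h3 : y + proj e t = y + proj (fun j => e j.castSucc) (fun j : Fin m => t j.castSucc) +
        t (Fin.last m) • e (Fin.last m) := by
      simp [proj, Fin.sum_univ_castSucc, add_assoc]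
    rw [h3]
    refine ⟨he _ _ h1 _ (ht _).le, ?_⟩
    ext x
    rw [iterPoisson, h2]
    exact linePoisson_slice hΩ hF hp hN hFN (he (Fin.last m)) h1 (ht _) x

end Slices

/-- If an affine function converges along a sequence, it converges to the same limit along convex
combinations of the tails. -/
lemma tendsto_of_mem_convexHull_tail {V : Type*} [AddCommGroup V] [Module ℝ V] {f g : ℕ → V}
    (hg : ∀ k, g k ∈ convexHull ℝ (f '' Ici k)) {S : Set V} (hS : Convex ℝ S) {Λ : V → ℂ}
    (hΛ : ∀ u ∈ S, ∀ v ∈ S, ∀ a b : ℝ, Λ (a • u + b • v) = a • Λ u + b • Λ v)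
    (hf : ∀ k, f k ∈ S) {l : ℂ} (hlim : Tendsto (fun k => Λ (f k)) atTop (𝓝 l)) :
    Tendsto (fun k => Λ (g k)) atTop (𝓝 l) := by
  rw [Metric.tendsto_atTop] at hlim ⊢
  intro ε hε
  obtain ⟨K, hK⟩ := hlim ε hε
  refine ⟨K, fun k hk => ?_⟩
  -- The right-hand set is convex because balls are and `Λ` respects combinations on `S`; it
  -- contains the tail, hence its hull.
  have hsub : convexHull ℝ (f '' Ici k) ⊆ {u ∈ S | Λ u ∈ Metric.ball l ε} := by
    refine convexHull_min ?_ ?_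
    · rintro _ ⟨j, hj, rfl⟩
      exact ⟨hf j, hK j (hk.trans hj)⟩
    · rintro u ⟨hu, hu'⟩ v ⟨hv, hv'⟩ a b ha hb hab
      refine ⟨hS hu hv ha hb hab, ?_⟩
      rw [hΛ u hu v hv]
      exact convex_ball l ε hu' hv' ha hb hab
  exact (hsub (hg k)).2

/-! ### Passage to the boundary -/

section Representation

variable {n m : ℕ}

lemma continuous_of_mem_convexHull {X : Type*} [TopologicalSpace X] {f : ℕ → X → ℂ}
    (hf : ∀ k, Continuous (f k)) {k : ℕ} {g : X → ℂ} (hg : g ∈ convexHull ℝ (f '' Ici k)) :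
    Continuous g := by
  have : convexHull ℝ (f '' Ici k) ⊆ {u | Continuous u} := by
    refine convexHull_min ?_ ?_
    · rintro _ ⟨j, -, rfl⟩
      exact hf j
    · intro u (hu : Continuous u) v (hv : Continuous v) a b _ _ _
      exact (hu.const_smul a).add (hv.const_smul b)
  exact this hg

/-- Passage to the limit in the iterated Poisson integral. -/
theorem tendsto_iterPoisson (hnm : n ≤ m) {e : Fin m → EuclideanSpace ℝ (Fin n)}
    (he : ∀ σ : Fin n ↪ Fin m, LinearIndependent ℝ fun k => e (σ k)) {p : ℝ} (hp : 1 < p)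
    {f g : ℕ → EuclideanSpace ℝ (Fin n) → ℂ} {G : EuclideanSpace ℝ (Fin n) → ℂ}
    (hfc : ∀ k, Continuous (f k)) (hf : ∀ k, MemLp (f k) (ENNReal.ofReal p) volume)
    (hg : ∀ k, g k ∈ convexHull ℝ (f '' Ici k))
    (hgL : ∀ k, MemLp (g k) (ENNReal.ofReal p) volume)
    (hGm : Measurable G) (hG : MemLp G (ENNReal.ofReal p) volume)
    (hlim : Tendsto (fun k => eLpNorm (g k - G) (ENNReal.ofReal p) volume) atTop (𝓝 0))
    {t : Fin m → ℝ} (ht : t ∈ orthant m) {x : EuclideanSpace ℝ (Fin n)} {l : ℂ}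
    (hfl : Tendsto (fun k => iterPoisson e t (f k) x) atTop (𝓝 l)) :
    iterPoisson e t G x = l := by
  set W : (Fin m → ℝ) → ℂ := fun s => ((∏ j, poisson (t j) (s j) : ℝ) : ℂ) with hW
  set Λ : (EuclideanSpace ℝ (Fin n) → ℂ) → ℂ := fun u => ∫ s, u (x - proj e s) * W s with hΛ
  -- Linearity of `Λ` is claimed only on `S`, since the Bochner integral of a non-integrable
  -- function is `0` by convention.
  set S : Set (EuclideanSpace ℝ (Fin n) → ℂ) :=
    {u | Integrable fun s => u (x - proj e s) * W s} with hS
  have hlin : ∀ u ∈ S, ∀ v ∈ S, ∀ a b : ℝ,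
      (fun s => (a • u + b • v) (x - proj e s) * W s) =
        (fun s => a • (u (x - proj e s) * W s)) + fun s => b • (v (x - proj e s) * W s) := by
    intro u _ v _ a b
    ext s
    simp only [Pi.add_apply, Pi.smul_apply, Complex.real_smul]
    ring
  have hSc : Convex ℝ S := by
    intro u hu v hv a b _ _ _
    change Integrable (fun s => (a • u + b • v) (x - proj e s) * W s)
    rw [hlin u hu v hv]
    exact (Integrable.smul a hu).add (Integrable.smul b hv)
  have hΛlin : ∀ u ∈ S, ∀ v ∈ S, ∀ a b : ℝ, Λ (a • u + b • v) = a • Λ u + b • Λ v := by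
    intro u hu v hv a b
    simp only [hΛ]
    have hu' : Integrable (fun s => a • (u (x - proj e s) * W s)) := Integrable.smul a hu
    have hv' : Integrable (fun s => b • (v (x - proj e s) * W s)) := Integrable.smul b hv
    rw [hlin u hu v hv, integral_add' hu' hv', integral_smul, integral_smul]
  have hmemS : ∀ u, Measurable u → MemLp u (ENNReal.ofReal p) volume → u ∈ S := fun u hum hu =>
    integrable_mul_prod_poisson hnm he ht hp hum hu x
  have hΛeq : ∀ u ∈ S, iterPoisson e t u x = Λ u := fun u hu =>
    iterPoisson_eq_integral u m e t ht x hu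
  have hfS : ∀ k, f k ∈ S := fun k => hmemS _ (hfc k).measurable (hf k)
  have hgm : ∀ k, Measurable (g k) := fun k => (continuous_of_mem_convexHull hfc (hg k)).measurable
  have hgS : ∀ k, g k ∈ S := fun k => hmemS _ (hgm k) (hgL k)
  have hGS : G ∈ S := hmemS _ hGm hG
  have h1 : Tendsto (fun k => Λ (g k)) atTop (𝓝 l) :=
    tendsto_of_mem_convexHull_tail hg hSc hΛlin hfS (hfl.congr fun k => hΛeq _ (hfS k))
  obtain ⟨c, hc, hcb⟩ := exists_lintegral_enorm_mul_poisson_le hnm he ht hp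
  have h2 : Tendsto (fun k => Λ (g k)) atTop (𝓝 (Λ G)) := by
    rw [tendsto_iff_edist_tendsto_0]
    have h3 : Tendsto (fun k => c * eLpNorm (g k - G) (ENNReal.ofReal p) volume) atTop (𝓝 0) := by
      simpa using ENNReal.Tendsto.const_mul hlim (Or.inr hc)
    refine tendsto_of_tendsto_of_tendsto_of_le_of_le tendsto_const_nhds h3 (fun _ => zero_le)
      fun k => ?_
    rw [edist_eq_enorm_sub, ← integral_sub (hgS k) hGS]
    refine (enorm_integral_le_lintegral_enorm _).trans ?_
    refine le_trans (le_of_eq ?_) (hcb (g k - G) ((hgm k).sub hGm) x)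
    refine lintegral_congr fun s => ?_
    rw [Pi.sub_apply, sub_mul]
  rw [hΛeq G hGS]
  exact tendsto_nhds_unique h2 h1

end Representation

/-! ### Construction of the boundary function -/

theorem mainTheorem2 (n m : ℕ) (hnm : n ≤ m)
    (e : Fin m → EuclideanSpace ℝ (Fin n))
    (he_unit : ∀ j, ‖e j‖ = 1)
    (he_indep : ∀ σ : Fin n ↪ Fin m, LinearIndependent ℝ (fun k => e (σ k)))
    (p : ℝ) (hp : 1 < p)
    (F : EuclideanSpace ℂ (Fin n) → ℂ) (hF : MemHardy (cone e) p F) :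
    ∃ Fb : EuclideanSpace ℝ (Fin n) → ℂ,
      MemLp Fb (ENNReal.ofReal p) volume ∧
      (∀ (x : EuclideanSpace ℝ (Fin n)), ∀ t ∈ orthant m,
        Integrable (fun s : Fin m → ℝ =>
          Fb (x - ∑ j, s j • e j) * ((∏ j, poisson (t j) (s j) : ℝ) : ℂ)) volume ∧
        F (cpoint x (proj e t)) = iterPoisson e t Fb x) ∧
      (ContinuousOn F (closure (tube (cone e))) →
        ∀ x : EuclideanSpace ℝ (Fin n),
          Tendsto (fun t : Fin m → ℝ => F (cpoint x (proj e t)))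
            (𝓝[orthant m] 0) (𝓝 (Fb x))) := by
  have hp0 : 0 < p := by linarith
  obtain ⟨hFd, hFfin⟩ := hF
  set N : ℝ≥0∞ := ⨆ y ∈ cone e, ∫⁻ x : EuclideanSpace ℝ (Fin n), ‖F (cpoint x y)‖ₑ ^ p with hNdef
  have hN : N < ∞ := by
    rw [hardyNorm, ENNReal.rpow_lt_top_iff_of_pos (by positivity)] at hFfin
    exact hFfin
  have hFN : ∀ y ∈ cone e, ∫⁻ x : EuclideanSpace ℝ (Fin n), ‖F (cpoint x y)‖ₑ ^ p ≤ N :=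
    fun y hy => le_iSup₂_of_le y hy le_rfl
  have hΩ : IsOpen (cone e) := isOpen_cone hnm he_indep
  have hslice : ∀ y ∈ cone e, Continuous fun x => F (cpoint x y) := fun y hy =>
    hFd.continuousOn.comp_continuous (continuous_cpoint.comp (continuous_id.prodMk
      continuous_const)) fun x => cpoint_mem_tube x hy
  set τ : ℕ → Fin m → ℝ := fun k _ => 1 / ((k : ℝ) + 1) with hτ
  have hτo : ∀ k, τ k ∈ orthant m := fun k j => by simp only [hτ]; positivity
  have hτlim : Tendsto (fun k => proj e (τ k)) atTop (𝓝 0) := by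
    have h1 : Tendsto τ atTop (𝓝 0) :=
      tendsto_pi_nhds.2 fun j => tendsto_one_div_add_atTop_nhds_zero_nat
    have h2 := ((continuous_proj e).tendsto 0).comp h1
    simpa [proj, Function.comp_def] using h2
  have hyΩ : ∀ k, proj e (τ k) ∈ cone e := fun k => proj_mem_cone e (hτo k)
  set f : ℕ → EuclideanSpace ℝ (Fin n) → ℂ := fun k x => F (cpoint x (proj e (τ k))) with hfdef
  have hfc : ∀ k, Continuous (f k) := fun k => hslice _ (hyΩ k)
  have hf : ∀ k, MemLp (f k) (ENNReal.ofReal p) volume := by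
    intro k
    refine ⟨(hfc k).aestronglyMeasurable, ?_⟩
    rw [eLpNorm_lt_top_iff_lintegral_rpow_enorm_lt_top (by simpa using hp0) ENNReal.ofReal_ne_top,
      ENNReal.toReal_ofReal hp0.le]
    exact (hFN _ (hyΩ k)).trans_lt hN
  have hfM : ∀ k, ∫ x, ‖f k x‖ ^ p ≤ N.toReal := by
    intro k
    rw [integral_eq_lintegral_of_nonneg_ae (Eventually.of_forall fun x => by positivity)
      (integrable_norm_rpow_of_memLp hp (hf k)).1]
    refine ENNReal.toReal_mono hN.ne (le_trans (le_of_eq ?_) (hFN _ (hyΩ k)))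
    refine lintegral_congr fun x => ?_
    rw [← ENNReal.ofReal_rpow_of_nonneg (norm_nonneg _) hp0.le, ofReal_norm]
  obtain ⟨g, G, hg, hgL, hG, hgG⟩ := exists_convexHull_tail_tendsto hp f hf N.toReal hfM
  -- Any measurable representative works, at every `x`: the limit argument sees it only through
  -- `L^p` distances. This leaves freedom to choose the continuous one below.
  have hrep : ∀ Fb : EuclideanSpace ℝ (Fin n) → ℂ, Measurable Fb → Fb =ᵐ[volume] G →
      MemLp Fb (ENNReal.ofReal p) volume ∧
      (∀ (x : EuclideanSpace ℝ (Fin n)), ∀ t ∈ orthant m,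
        Integrable (fun s : Fin m → ℝ =>
          Fb (x - ∑ j, s j • e j) * ((∏ j, poisson (t j) (s j) : ℝ) : ℂ)) volume ∧
        F (cpoint x (proj e t)) = iterPoisson e t Fb x) := by
    intro Fb hFbm hFbG
    have hFb : MemLp Fb (ENNReal.ofReal p) volume := (memLp_congr_ae hFbG).2 hG
    refine ⟨hFb, fun x t ht =>
      ⟨integrable_mul_prod_poisson hnm he_indep ht hp hFbm hFb x, ?_⟩⟩
    refine (tendsto_iterPoisson hnm he_indep hp hfc hf hg hgL hFbm hFb ?_ ht ?_).symm
    · refine hgG.congr fun k => eLpNorm_congr_ae ?_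
      exact (ae_eq_refl _).sub hFbG.symm
    · have h1 : ∀ k, iterPoisson e t (f k) x = F (cpoint x (proj e (τ k) + proj e t)) := fun k =>
        congrFun (iterPoisson_slice hΩ hFd hp hN hFN m e
          (fun j y hy a ha => add_smul_mem_cone j hy ha) t ht _ (hyΩ k)).2 x
      simp only [h1]
      have hmem : ∀ k, cpoint x (proj e (τ k) + proj e t) ∈ tube (cone e) := fun k =>
        cpoint_mem_tube _ (iterPoisson_slice hΩ hFd hp hN hFN m e
          (fun j y hy a ha => add_smul_mem_cone j hy ha) t ht _ (hyΩ k)).1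
      have h2 := hFd.continuousOn (cpoint x (proj e t)) (cpoint_mem_tube x (proj_mem_cone e ht))
      refine h2.tendsto.comp (tendsto_nhdsWithin_iff.2 ⟨?_, Eventually.of_forall hmem⟩)
      have h3 : Tendsto (fun k => (x, proj e (τ k) + proj e t)) atTop (𝓝 (x, proj e t)) := by
        have := hτlim.add_const (proj e t)
        rw [zero_add] at this
        exact tendsto_const_nhds.prodMk_nhds this
      exact (continuous_cpoint.tendsto _).comp h3
  -- The same `Fb` must serve both conclusions, so the representative is chosen according to whether
  -- `F` extends continuously; otherwise the last clause is vacuous.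
  by_cases hcont : ContinuousOn F (closure (tube (cone e)))
  · have hlimpt : ∀ x, Tendsto (fun k => cpoint x (proj e (τ k))) atTop (𝓝 (cpoint x 0)) :=
      fun x => (continuous_cpoint.tendsto (x, 0)).comp (tendsto_const_nhds.prodMk_nhds hτlim)
    have hmem : ∀ x, cpoint x 0 ∈ closure (tube (cone e)) := fun x =>
      mem_closure_of_tendsto (hlimpt x)
        (Eventually.of_forall fun k => cpoint_mem_tube x (hyΩ k))
    have hFbc : Continuous fun x => F (cpoint x 0) :=
      hcont.comp_continuous (continuous_cpoint.comp (continuous_id.prodMk continuous_const)) hmem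
    have hflim : ∀ x, Tendsto (fun k => f k x) atTop (𝓝 (F (cpoint x 0))) := fun x =>
      (hcont _ (hmem x)).tendsto.comp (tendsto_nhdsWithin_iff.2 ⟨hlimpt x,
        Eventually.of_forall fun k => subset_closure (cpoint_mem_tube x (hyΩ k))⟩)
    have hglim : ∀ x, Tendsto (fun k => g k x) atTop (𝓝 (F (cpoint x 0))) := fun x =>
      tendsto_of_mem_convexHull_tail hg convex_univ (Λ := fun u => u x)
        (fun u _ v _ a b => rfl) (fun k => mem_univ _) (hflim x)
    -- The `g k` converge everywhere to the boundary values of `F`, and a subsequence converges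
    -- almost everywhere to `G`.
    have hae : (fun x => F (cpoint x 0)) =ᵐ[volume] G := by
      obtain ⟨φ, hφ, hφlim⟩ := (tendstoInMeasure_of_tendsto_eLpNorm (by simpa using hp0)
        (fun k => (hgL k).1) hG.1 hgG).exists_seq_tendsto_ae
      filter_upwards [hφlim] with x hx
      exact tendsto_nhds_unique ((hglim x).comp hφ.tendsto_atTop) hx
    obtain ⟨h1, h2⟩ := hrep _ hFbc.measurable hae
    refine ⟨_, h1, h2, fun _ x => ?_⟩
    refine (hcont _ (hmem x)).tendsto.comp (tendsto_nhdsWithin_iff.2 ⟨?_, ?_⟩)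
    · have h3 : Continuous fun t : Fin m → ℝ => cpoint x (proj e t) :=
        continuous_cpoint.comp (continuous_const.prodMk (continuous_proj e))
      have h4 := h3.tendsto 0
      rw [show proj e 0 = 0 by simp [proj]] at h4
      exact h4.mono_left nhdsWithin_le_nhds
    · filter_upwards [self_mem_nhdsWithin] with t ht
      exact subset_closure (cpoint_mem_tube x (proj_mem_cone e ht))
  · obtain ⟨h1, h2⟩ := hrep (hG.1.mk G) hG.1.stronglyMeasurable_mk.measurable
      hG.1.ae_eq_mk.symm
    exact ⟨_, h1, h2, fun h => absurd h hcont⟩
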